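/- Let $a<b$ and let $A,B,C$ be the coefficients of a symplectic differential system $v'=Av+B\alpha$, $\alpha'=Cv-A^*\alpha$ in $\mathbb R^n$ on $[a,b]$: $A(t)\in\mathcal L(\mathbb R^n)$ and $B(t)\in\mathcal L({\mathbb R^n}^*,\mathbb R^n)$ are of class $C^1$ in $t$, $C(t)\in\mathcal L(\mathbb R^n,{\mathbb R^n}^*)$ is continuous in $t$, $B(t)$ and $C(t)$ are symmetric as bilinear forms, and $B(t)$ is invertible. Let $\ell_0\subset\mathbb R^n\oplus{\mathbb R^n}^*$ be a Lagrangian subspace for $\omega((v_1,\alpha_1),(v_2,\alpha_2))=\alpha_2(v_1)-\alpha_1(v_2)$, let $P\subset\mathbb R^n$ be its projection on $\mathbb R^n$, and assume that the bilinear form $B(a)^{-1}$ is nondegenerate on $P$. Let $\mathcal H=H^1_P([a,b];\mathbb R^n)$ be the Hilbert space of all $v\in H^1([a,b];\mathbb R^n)$ with $v(a)\in P$ and $v(b)=0$, and put $\alpha_v=B^{-1}(v'-Av)$. Suppose that $B(t)$ has index (negative type number) $k$ for all $t\in[a,b]$, and let $\mathcal D=\{\mathcal D_t\}_{t\in[a,b]}$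 be a family of $k$-dimensional subspaces of $\mathbb R^n$ such that $B(t)^{-1}$ is negative definite on $\mathcal D_t$ for each $t$, and such that there are maps $Y_1,\dots,Y_k:[a,b]\to\mathbb R^n$ of class $C^2$ for which $Y_1(t),\dots,Y_k(t)$ is a basis of $\mathcal D_t$ for each $t$. Set $$\mathcal K=\big\{v\in\mathcal H:\ \alpha_v(Y_i)\in H^1([a,b];\mathbb R),\ \ \alpha_v(Y_i)'=B(\alpha_v,\alpha_{Y_i})+C(v,Y_i),\ i=1,\dots,k\big\},$$ $$\mathcal S=\big\{v\in H^1([a,b];\mathbb R^n):\ v(a)=v(b)=0,\ v(t)\in\mathcal D_t\ \text{for all } t\in[a,b]\big\}.$$ Let $\mathcal B_{ij}=B^{-1}(Y_i,Y_j)$, $\mathcal C_{ij}=\alpha_{Y_j}(Y_i)$, $\mathcal I_{ij}=B(\alpha_{Y_i},\alpha_{Y_j})+C(Y_i,Y_j)$, and let $\mathcal C_{\mathrm s}$ and $\mathcal C_{\mathrm a}$ be the symmetric and the antisymmetric part of the matrix $\mathcal C$. Assume that the reduced symplectic system $$f'=-\mathcal B^{-1}\mathcal C_{\mathrm a}f+\mathcal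 B^{-1}\varphi,\qquad \varphi'=(\mathcal I-\mathcal C_{\mathrm s}'+\mathcal C_{\mathrm a}\mathcal B^{-1}\mathcal C_{\mathrm a})f-\mathcal C_{\mathrm a}\mathcal B^{-1}\varphi$$ on $[a,b]$ with initial condition $f(a)=0$ has no focal instants: if $(f,\varphi)$ is a solution with $f(a)=0$ and $f\not\equiv0$, then $f(t)\neq0$ for all $t\in\,]a,b]$. Then $\mathcal K$ and $\mathcal S$ are closed subspaces of $\mathcal H$ and $\mathcal H=\mathcal K\oplus\mathcal S$. -/

import Mathlib

open Set MeasureTheory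

noncomputable section

namespace SymplecticIndex

/-! ### Sobolev spaces on a compact interval -/

section Sobolev

variable {E : Type*} [NormedAddCommGroup E] [InnerProductSpace ℝ E] [FiniteDimensional ℝ E]
variable {a b : ℝ}

/-- `v` restricts to an element of `H¹([a,b]; E)`: it is absolutely continuous on `[a,b]` and its
(almost everywhere existing) derivative is square integrable there.  Only the values of `v` on
`[a,b]` matter. -/
def MemH1 (a b : ℝ) (v : ℝ → E) : Prop :=
  AbsolutelyContinuousOnInterval v a b ∧
    MemLp (derivWithin v (Icc a b)) 2 (volume.restrict (Icc a b))

theorem MemH1.ae_hasDerivWithinAt (hab : a < b) {v : ℝ → E} (hv : MemH1 a b v) :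
    ∀ᵐ t ∂(volume.restrict (Icc a b)),
      HasDerivWithinAt v (derivWithin v (Icc a b) t) (Icc a b) t := by
  have h := hv.1.boundedVariationOn.ae_differentiableAt_of_mem_uIcc
  rw [ae_restrict_iff' measurableSet_Icc]
  filter_upwards [h] with t ht htI
  rw [uIcc_of_le hab.le] at ht
  exact (ht htI).differentiableWithinAt.hasDerivWithinAt

theorem MemH1.ae_derivWithin_add (hab : a < b) {v w : ℝ → E} (hv : MemH1 a b v)
    (hw : MemH1 a b w) :
    derivWithin (v + w) (Icc a b) =ᵐ[volume.restrict (Icc a b)]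
      derivWithin v (Icc a b) + derivWithin w (Icc a b) := by
  filter_upwards [hv.ae_hasDerivWithinAt hab, hw.ae_hasDerivWithinAt hab,
    ae_restrict_mem measurableSet_Icc] with t h1 h2 ht
  exact (h1.add h2).derivWithin (uniqueDiffOn_Icc hab t ht)

theorem MemH1.ae_derivWithin_smul (hab : a < b) (c : ℝ) {v : ℝ → E} (hv : MemH1 a b v) :
    derivWithin (c • v) (Icc a b) =ᵐ[volume.restrict (Icc a b)]
      c • derivWithin v (Icc a b) := by
  filter_upwards [hv.ae_hasDerivWithinAt hab, ae_restrict_mem measurableSet_Icc] with t h1 ht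
  exact (h1.const_smul c).derivWithin (uniqueDiffOn_Icc hab t ht)

theorem MemH1.add (hab : a < b) {v w : ℝ → E} (hv : MemH1 a b v) (hw : MemH1 a b w) :
    MemH1 a b (v + w) :=
  ⟨hv.1.add hw.1, (memLp_congr_ae (hv.ae_derivWithin_add hab hw)).2 (hv.2.add hw.2)⟩

theorem MemH1.const_smul (hab : a < b) (c : ℝ) {v : ℝ → E} (hv : MemH1 a b v) :
    MemH1 a b (c • v) :=
  ⟨hv.1.const_smul c, (memLp_congr_ae (hv.ae_derivWithin_smul hab c)).2 (hv.2.const_smul c)⟩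

theorem MemH1.zero : MemH1 a b (0 : ℝ → E) := by
  refine ⟨?_, ?_⟩
  · exact (LipschitzWith.const (0 : E)).lipschitzOnWith.absolutelyContinuousOnInterval
  · have h : derivWithin (0 : ℝ → E) (Icc a b) = 0 := by
      funext t
      exact congrFun (derivWithin_const (Icc a b) (0 : E)) t
    rw [h]
    exact MemLp.zero

theorem MemH1.memLp (hab : a < b) {v : ℝ → E} (hv : MemH1 a b v) :
    MemLp v 2 (volume.restrict (Icc a b)) := by
  have hc : ContinuousOn v (Icc a b) := by
    simpa [uIcc_of_le hab.le] using hv.1.continuousOn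
  obtain ⟨M, hM⟩ := isCompact_Icc.exists_bound_of_continuousOn hc
  exact MemLp.of_bound (hc.aestronglyMeasurable measurableSet_Icc) M
    ((ae_restrict_iff' measurableSet_Icc).2 (Filter.Eventually.of_forall hM))

/-- `H¹([a,b]; E)` as a space of functions on `[a,b]`. -/
def h1Submodule (E : Type*) [NormedAddCommGroup E] [InnerProductSpace ℝ E]
    [FiniteDimensional ℝ E] {a b : ℝ} (hab : a < b) : Submodule ℝ (Icc a b → E) where
  carrier := {v | MemH1 a b (IccExtend hab.le v)}
  add_mem' hv hw := MemH1.add hab hv hw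
  zero_mem' := MemH1.zero
  smul_mem' c _ hv := MemH1.const_smul hab c hv

/-- The Sobolev space `H¹([a,b]; E)`.  It is a type of its own so that it carries the `H¹` inner
product (below) and not the topology of pointwise convergence. -/
def H1 (E : Type*) [NormedAddCommGroup E] [InnerProductSpace ℝ E]
    [FiniteDimensional ℝ E] {a b : ℝ} (hab : a < b) : Type _ := h1Submodule E hab

namespace H1

variable {hab : a < b}

instance : AddCommGroup (H1 E hab) := inferInstanceAs (AddCommGroup (h1Submodule E hab))
instance : Module ℝ (H1 E hab) := inferInstanceAs (Module ℝ (h1Submodule E hab))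

/-- The function `v`, extended from `[a,b]` to `ℝ` by its end values. -/
def fn (v : H1 E hab) : ℝ → E := IccExtend hab.le v.1

theorem memH1 (v : H1 E hab) : MemH1 a b v.fn := v.2
theorem fn_add (v w : H1 E hab) : (v + w).fn = v.fn + w.fn := rfl
theorem fn_smul (c : ℝ) (v : H1 E hab) : (c • v).fn = c • v.fn := rfl
theorem fn_zero : (0 : H1 E hab).fn = 0 := rfl

/-- The derivative `v'`, defined almost everywhere on `[a,b]`. -/
def deriv (v : H1 E hab) : ℝ → E := derivWithin v.fn (Icc a b)

/-- The map `v ↦ (v, v')` into `L² × L²`. -/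
def toL2 (E : Type*) [NormedAddCommGroup E] [InnerProductSpace ℝ E]
    [FiniteDimensional ℝ E] {a b : ℝ} (hab : a < b) :
    H1 E hab →ₗ[ℝ] WithLp 2 (Lp E 2 (volume.restrict (Icc a b)) ×
      Lp E 2 (volume.restrict (Icc a b))) where
  toFun v := WithLp.toLp 2 ((v.memH1.memLp hab).toLp v.fn, v.memH1.2.toLp v.deriv)
  map_add' v w := by
    refine congrArg (WithLp.toLp 2) (Prod.ext ?_ ?_)
    · exact MemLp.toLp_add (v.memH1.memLp hab) (w.memH1.memLp hab)
    · exact (MemLp.toLp_congr (v + w).memH1.2 (v.memH1.2.add w.memH1.2)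
        (v.memH1.ae_derivWithin_add hab w.memH1)).trans (MemLp.toLp_add v.memH1.2 w.memH1.2)
  map_smul' c v := by
    refine congrArg (WithLp.toLp 2) (Prod.ext ?_ ?_)
    · exact MemLp.toLp_const_smul c (v.memH1.memLp hab)
    · exact (MemLp.toLp_congr (c • v).memH1.2 (v.memH1.2.const_smul c)
        (v.memH1.ae_derivWithin_smul hab c)).trans (MemLp.toLp_const_smul c v.memH1.2)

theorem toL2_injective : Function.Injective (toL2 E hab) := by
  rw [injective_iff_map_eq_zero]
  intro v hv
  have h1 : (v.memH1.memLp hab).toLp v.fn = 0 := congrArg (fun p => p.fst) hv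
  have h2 : v.fn =ᵐ[volume.restrict (Icc a b)] fun _ => (0 : E) :=
    (MemLp.coeFn_toLp (v.memH1.memLp hab)).symm.trans (h1 ▸ Lp.coeFn_zero ..)
  have hc : ContinuousOn v.fn (Icc a b) := by
    simpa [uIcc_of_le hab.le] using v.memH1.1.continuousOn
  have h3 : EqOn v.fn (fun _ => 0) (Icc a b) :=
    Measure.eqOn_Icc_of_ae_eq volume hab.ne h2 hc continuousOn_const
  apply Subtype.ext
  funext t
  have h4 := h3 t.2
  have h5 : v.fn t = v.1 t := by simp [fn]
  exact h5.symm.trans h4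

/-- The inner product `⟨v, w⟩ = ∫ ⟨v, w⟩ + ∫ ⟨v', w'⟩` of `H¹`. -/
instance : Inner ℝ (H1 E hab) := ⟨fun v w =>
  (∫ t in Icc a b, inner ℝ (v.fn t) (w.fn t)) + ∫ t in Icc a b, inner ℝ (v.deriv t) (w.deriv t)⟩

theorem inner_eq (v w : H1 E hab) : inner ℝ v w = inner ℝ (toL2 E hab v) (toL2 E hab w) := by
  change (∫ t in Icc a b, inner ℝ (v.fn t) (w.fn t)) +
      ∫ t in Icc a b, inner ℝ (v.deriv t) (w.deriv t) = _
  rw [WithLp.prod_inner_apply, L2.inner_def, L2.inner_def]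
  congr 1
  · refine integral_congr_ae ?_
    filter_upwards [MemLp.coeFn_toLp (v.memH1.memLp hab), MemLp.coeFn_toLp (w.memH1.memLp hab)]
      with t h1 h2
    exact (congrArg₂ (inner ℝ) h1 h2).symm
  · refine integral_congr_ae ?_
    filter_upwards [MemLp.coeFn_toLp v.memH1.2, MemLp.coeFn_toLp w.memH1.2] with t h1 h2
    exact (congrArg₂ (inner ℝ) h1 h2).symm

@[reducible] def core : InnerProductSpace.Core ℝ (H1 E hab) where
  toInner := inferInstance
  conj_inner_symm v w := by simp only [inner_eq]; exact inner_conj_symm _ _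
  re_inner_nonneg v := by simp only [inner_eq]; exact inner_self_nonneg
  add_left u v w := by simp only [inner_eq, map_add]; exact inner_add_left _ _ _
  smul_left u v c := by simp only [inner_eq, map_smul]; exact inner_smul_left _ _ _
  definite v hv := by
    rw [inner_eq, inner_self_eq_zero] at hv
    exact toL2_injective (hv.trans (map_zero _).symm)

instance : NormedAddCommGroup (H1 E hab) := core.toNormedAddCommGroup
instance : InnerProductSpace ℝ (H1 E hab) := InnerProductSpace.ofCore core.toCore

end H1

end Sobolev

/-! ### Symplectic differential systems -/

/-- `ℝⁿ`. -/
abbrev Vec (n : ℕ) := EuclideanSpace ℝ (Fin n)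

/-- The dual space of `ℝⁿ`. -/
abbrev Covec (n : ℕ) := StrongDual ℝ (Vec n)

/-- The index (negative type number) of a bilinear form: the supremum of the dimensions of the
subspaces on which it is negative definite. -/
def negIndex {V : Type*} [AddCommGroup V] [Module ℝ V] (β : V → V → ℝ) : ℕ∞ :=
  ⨆ W : {W : Submodule ℝ V // ∀ x ∈ W, x ≠ 0 → β x x < 0}, Cardinal.toENat (Module.rank ℝ W.1)

/-- The canonical symplectic form `ω((v₁,α₁),(v₂,α₂)) = α₂(v₁) - α₁(v₂)`. -/
def omega {n : ℕ} (x y : Vec n × Covec n) : ℝ := y.2 x.1 - x.2 y.1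

/-- Lagrangian subspaces: `n`-dimensional and `ω`-isotropic. -/
def IsLagrangian {n : ℕ} (ℓ : Submodule ℝ (Vec n × Covec n)) : Prop :=
  Module.finrank ℝ ℓ = n ∧ ∀ x ∈ ℓ, ∀ y ∈ ℓ, omega x y = 0

/-- The coefficients of a symplectic differential system `v' = A v + B α`, `α' = C v - A^* α` on
`[a,b]`: `A` and `B` are `C¹`, `C` is continuous, `B` and `C` are symmetric, `B` is invertible. -/
structure SymplecticSystem (n : ℕ) (a b : ℝ) where
  A : ℝ → Vec n →L[ℝ] Vec n
  B : ℝ → Covec n →L[ℝ] Vec n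
  C : ℝ → Vec n →L[ℝ] Covec n
  contDiffOn_A : ContDiffOn ℝ 1 A (Icc a b)
  contDiffOn_B : ContDiffOn ℝ 1 B (Icc a b)
  continuousOn_C : ContinuousOn C (Icc a b)
  symm_B : ∀ t ∈ Icc a b, ∀ α β : Covec n, β (B t α) = α (B t β)
  symm_C : ∀ t ∈ Icc a b, ∀ v w : Vec n, C t v w = C t w v
  invertible_B : ∀ t ∈ Icc a b, (B t).IsInvertible

namespace SymplecticSystem

variable {n k : ℕ} {a b : ℝ} (X : SymplecticSystem n a b)

/-- `B(t)` as a bilinear form on the dual of `ℝⁿ`. -/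
def formB (t : ℝ) (α β : Covec n) : ℝ := β (X.B t α)

/-- `B(t)⁻¹`; as a bilinear form on `ℝⁿ` it is `(x, y) ↦ X.invB t x y`. -/
def invB (t : ℝ) : Vec n →L[ℝ] Covec n := (X.B t).inverse

/-- `α_v = B⁻¹ (v' - A v)`. -/
def alpha (v : ℝ → Vec n) (t : ℝ) : Covec n :=
  X.invB t (derivWithin v (Icc a b) t - X.A t (v t))

/-- `𝓑ᵢⱼ = B⁻¹(Yᵢ, Yⱼ)`. -/
def redB (Y : Fin k → ℝ → Vec n) (t : ℝ) : Matrix (Fin k) (Fin k) ℝ :=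
  Matrix.of fun i j => X.invB t (Y i t) (Y j t)

/-- `𝓒ᵢⱼ = α_{Yⱼ}(Yᵢ)`. -/
def redC (Y : Fin k → ℝ → Vec n) (t : ℝ) : Matrix (Fin k) (Fin k) ℝ :=
  Matrix.of fun i j => X.alpha (Y j) t (Y i t)

/-- The symmetric part of `𝓒`. -/
def redCs (Y : Fin k → ℝ → Vec n) (t : ℝ) : Matrix (Fin k) (Fin k) ℝ :=
  (1 / 2 : ℝ) • (X.redC Y t + (X.redC Y t).transpose)

/-- The antisymmetric part of `𝓒`. -/
def redCa (Y : Fin k → ℝ → Vec n) (t : ℝ) : Matrix (Fin k) (Fin k) ℝ :=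
  (1 / 2 : ℝ) • (X.redC Y t - (X.redC Y t).transpose)

/-- The derivative of the symmetric part of `𝓒`, entry by entry. -/
def redCsDeriv (Y : Fin k → ℝ → Vec n) (t : ℝ) : Matrix (Fin k) (Fin k) ℝ :=
  Matrix.of fun i j => derivWithin (fun s => X.redCs Y s i j) (Icc a b) t

/-- `𝓘ᵢⱼ = B(α_{Yᵢ}, α_{Yⱼ}) + C(Yᵢ, Yⱼ)`. -/
def redI (Y : Fin k → ℝ → Vec n) (t : ℝ) : Matrix (Fin k) (Fin k) ℝ :=
  Matrix.of fun i j => X.formB t (X.alpha (Y i) t) (X.alpha (Y j) t) + X.C t (Y i t) (Y j t)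

/-- `(f, φ)` solves on `[a,b]` the reduced symplectic system associated with the frame `Y`:
`f' = -𝓑⁻¹ 𝓒ₐ f + 𝓑⁻¹ φ`, `φ' = (𝓘 - 𝓒ₛ' + 𝓒ₐ 𝓑⁻¹ 𝓒ₐ) f - 𝓒ₐ 𝓑⁻¹ φ`.  Covectors of `ℝᵏ` are
written in the dual canonical basis. -/
def IsReducedSolution (Y : Fin k → ℝ → Vec n) (f φ : ℝ → Fin k → ℝ) : Prop :=
  ∀ t ∈ Icc a b,
    HasDerivWithinAt f
      (-(((X.redB Y t)⁻¹ * X.redCa Y t).mulVec (f t)) + ((X.redB Y t)⁻¹).mulVec (φ t))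
      (Icc a b) t ∧
    HasDerivWithinAt φ
      ((X.redI Y t - X.redCsDeriv Y t + X.redCa Y t * (X.redB Y t)⁻¹ * X.redCa Y t).mulVec (f t) -
        (X.redCa Y t * (X.redB Y t)⁻¹).mulVec (φ t))
      (Icc a b) t

/-- The reduced symplectic system with initial condition `f(a) = 0` has no focal instants in
`]a,b]`: a non-zero solution `f` with `f(a) = 0` does not vanish in `]a,b]`. -/
def ReducedHasNoFocalInstants (Y : Fin k → ℝ → Vec n) : Prop :=
  ∀ f φ : ℝ → Fin k → ℝ, X.IsReducedSolution Y f φ → f a = 0 →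
    (∃ t ∈ Icc a b, f t ≠ 0) → ∀ t ∈ Ioc a b, f t ≠ 0

/-- `𝒟` is a distribution of `k`-dimensional subspaces of `ℝⁿ` on which `B⁻¹` is negative
definite. -/
structure IsNegativeDistribution (k : ℕ) (D : ℝ → Submodule ℝ (Vec n)) : Prop where
  finrank_eq : ∀ t ∈ Icc a b, Module.finrank ℝ (D t) = k
  neg : ∀ t ∈ Icc a b, ∀ x ∈ D t, x ≠ 0 → X.invB t x x < 0

end SymplecticSystem

/-- `Y₁, …, Yₖ` is a frame of class `C²` of the distribution `𝒟` on `[a,b]`. -/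
structure IsC2Frame {n k : ℕ} (a b : ℝ) (Y : Fin k → ℝ → Vec n)
    (D : ℝ → Submodule ℝ (Vec n)) : Prop where
  contDiffOn : ∀ i, ContDiffOn ℝ 2 (Y i) (Icc a b)
  linearIndependent : ∀ t ∈ Icc a b, LinearIndependent ℝ fun i => Y i t
  span_eq : ∀ t ∈ Icc a b, Submodule.span ℝ (range fun i => Y i t) = D t

/-- A set of data `(X, ℓ₀)` for the symplectic differential problem: a symplectic differential
system and a Lagrangian subspace `ℓ₀` such that `B(a)⁻¹` is nondegenerate on
`P = {v | ∃ α, (v, α) ∈ ℓ₀}`. -/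
structure SymplecticData (n : ℕ) (a b : ℝ) extends SymplecticSystem n a b where
  ell : Submodule ℝ (Vec n × Covec n)
  lagrangian : IsLagrangian ell
  nondegenerate : ∀ v ∈ ell.map (LinearMap.fst ℝ (Vec n) (Covec n)),
    (∀ w ∈ ell.map (LinearMap.fst ℝ (Vec n) (Covec n)), toSymplecticSystem.invB a v w = 0) → v = 0

/-- The subspace `P` of `ℝⁿ` determined by the Lagrangian `ℓ₀`. -/
def SymplecticData.P {n : ℕ} {a b : ℝ} (X : SymplecticData n a b) : Submodule ℝ (Vec n) :=
  X.ell.map (LinearMap.fst ℝ (Vec n) (Covec n))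

/-! ### The spaces `ℋ`, `𝒦` and `𝒮` -/

/-- `H¹_P([a,b]; ℝⁿ)`: the `H¹` functions `v` with `v(a) ∈ P` and `v(b) = 0`, with the inner
product of `H¹`. -/
def H1P {n : ℕ} {a b : ℝ} (hab : a < b) (P : Submodule ℝ (Vec n)) :
    Submodule ℝ (H1 (Vec n) hab) where
  carrier := {v | v.fn a ∈ P ∧ v.fn b = 0}
  add_mem' {v w} hv hw := by
    refine ⟨P.add_mem hv.1 hw.1, ?_⟩
    change v.fn b + w.fn b = 0
    rw [hv.2, hw.2, add_zero]
  zero_mem' := ⟨P.zero_mem, rfl⟩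
  smul_mem' c v hv := by
    refine ⟨P.smul_mem c hv.1, ?_⟩
    change c • v.fn b = 0
    rw [hv.2, smul_zero]

namespace SymplecticData

variable {n k : ℕ} {a b : ℝ} (X : SymplecticData n a b) (hab : a < b)

/-- The space `ℋ = H¹_P([a,b]; ℝⁿ)`. -/
abbrev calH : Submodule ℝ (H1 (Vec n) hab) := H1P hab X.P

theorem ae_alpha_add (v w : H1 (Vec n) hab) :
    ∀ᵐ t ∂(volume.restrict (Icc a b)),
      X.alpha (v + w).fn t = X.alpha v.fn t + X.alpha w.fn t := by
  filter_upwards [v.memH1.ae_derivWithin_add hab w.memH1] with t ht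
  simp only [SymplecticSystem.alpha, H1.fn_add, ht, Pi.add_apply, map_add, map_sub]
  abel

theorem ae_alpha_smul (c : ℝ) (v : H1 (Vec n) hab) :
    ∀ᵐ t ∂(volume.restrict (Icc a b)),
      X.alpha (c • v).fn t = c • X.alpha v.fn t := by
  filter_upwards [v.memH1.ae_derivWithin_smul hab c] with t ht
  simp only [SymplecticSystem.alpha, H1.fn_smul, ht, Pi.smul_apply, map_smul, map_sub, smul_sub]

/-- The condition defining `𝒦` in the direction `y`: the (almost everywhere defined) function
`α_v(y)` is in `H¹([a,b]; ℝ)`, that is, it has an `H¹` representative `h`, and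
`h' = B(α_v, α_y) + C(v, y)` almost everywhere. -/
def SolvesAlong (v : ℝ → Vec n) (y : ℝ → Vec n) : Prop :=
  ∃ h : ℝ → ℝ, MemH1 a b h ∧
    (∀ᵐ t ∂(volume.restrict (Icc a b)), h t = X.alpha v t (y t)) ∧
    ∀ᵐ t ∂(volume.restrict (Icc a b)),
      derivWithin h (Icc a b) t = X.formB t (X.alpha v t) (X.alpha y t) + X.C t (v t) (y t)

/-- The space `𝒦 ⊆ ℋ` of the functions that solve the system along `Y₁, …, Yₖ`. -/
def calK (Y : Fin k → ℝ → Vec n) : Submodule ℝ (X.calH hab) where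
  carrier := {v | ∀ i, X.SolvesAlong v.1.fn (Y i)}
  add_mem' {v w} hv hw i := by
    obtain ⟨h, h1, h2, h3⟩ := hv i
    obtain ⟨g, g1, g2, g3⟩ := hw i
    refine ⟨h + g, h1.add hab g1, ?_, ?_⟩
    · filter_upwards [h2, g2, X.ae_alpha_add hab v.1 w.1] with t ht gt e
      change h t + g t = X.alpha (v.1 + w.1).fn t (Y i t)
      rw [e, ht, gt]
      rfl
    · filter_upwards [h3, g3, X.ae_alpha_add hab v.1 w.1, h1.ae_derivWithin_add hab g1]
        with t ht gt e d
      change _ = X.formB t (X.alpha (v.1 + w.1).fn t) (X.alpha (Y i) t) +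
        X.C t (v.1.fn t + w.1.fn t) (Y i t)
      rw [d, e, Pi.add_apply, ht, gt]
      simp only [SymplecticSystem.formB, map_add, _root_.add_apply]
      ring
  zero_mem' i := by
    refine ⟨0, MemH1.zero, ?_, ?_⟩
    · refine Filter.Eventually.of_forall fun t => ?_
      change (0 : ℝ) = X.alpha 0 t (Y i t)
      simp [SymplecticSystem.alpha]
    · refine Filter.Eventually.of_forall fun t => ?_
      change _ = X.formB t (X.alpha 0 t) (X.alpha (Y i) t) + X.C t 0 (Y i t)
      simp [SymplecticSystem.alpha, SymplecticSystem.formB]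
  smul_mem' c v hv i := by
    obtain ⟨h, h1, h2, h3⟩ := hv i
    refine ⟨c • h, h1.const_smul hab c, ?_, ?_⟩
    · filter_upwards [h2, X.ae_alpha_smul hab c v.1] with t ht e
      change c * h t = X.alpha (c • v.1).fn t (Y i t)
      rw [e, ht]
      rfl
    · filter_upwards [h3, X.ae_alpha_smul hab c v.1, h1.ae_derivWithin_smul hab c]
        with t ht e d
      change _ = X.formB t (X.alpha (c • v.1).fn t) (X.alpha (Y i) t) +
        X.C t (c • v.1.fn t) (Y i t)
      rw [d, e, Pi.smul_apply, ht]
      simp only [SymplecticSystem.formB, map_smul, _root_.smul_apply, smul_eq_mul]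
      ring

/-- The space `𝒮 = {v ∈ H¹₀([a,b]; ℝⁿ) | v(t) ∈ 𝒟(t) for all t}`, as a subspace of `ℋ`. -/
def calS (D : ℝ → Submodule ℝ (Vec n)) : Submodule ℝ (X.calH hab) where
  carrier := {v | v.1.fn a = 0 ∧ v.1.fn b = 0 ∧ ∀ t ∈ Icc a b, v.1.fn t ∈ D t}
  add_mem' {v w} hv hw := by
    refine ⟨?_, ?_, fun t ht => (D t).add_mem (hv.2.2 t ht) (hw.2.2 t ht)⟩
    · change v.1.fn a + w.1.fn a = 0
      rw [hv.1, hw.1, add_zero]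
    · change v.1.fn b + w.1.fn b = 0
      rw [hv.2.1, hw.2.1, add_zero]
  zero_mem' := ⟨rfl, rfl, fun t _ => (D t).zero_mem⟩
  smul_mem' c v hv := by
    refine ⟨?_, ?_, fun t ht => (D t).smul_mem c (hv.2.2 t ht)⟩
    · change c • v.1.fn a = 0
      rw [hv.1, smul_zero]
    · change c • v.1.fn b = 0
      rw [hv.2.1, smul_zero]

end SymplecticData

end SymplecticIndex

end

namespace SymplecticIndex

/-! ### Calculus of absolutely continuous functions with a prescribed almost everywhere derivative
-/

section WeakDeriv

variable {E F : Type*} [NormedAddCommGroup E] [NormedSpace ℝ E]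
  [NormedAddCommGroup F] [NormedSpace ℝ F] {a b : ℝ}

/-! Membership in 𝒦 is a condition on two first order expressions in `v`: the function uᵢ = B⁻¹(Yᵢ,
v' - Av) must have an absolutely continuous representative whose derivative is gᵢ = α_{Yᵢ}(v' - Av)
+ C(Yᵢ, v) (`solvesAlong_iff`). Along a section v = ∑ fⱼYⱼ of 𝒟 these become u = 𝒞f + 𝓑f' and g = 𝓘f
+ 𝒞ᵀf'. Putting φ = u - 𝒞ₛf = 𝓑f' + 𝒞ₐf, the equation u' = g turns into φ' = (𝓘 - 𝒞ₛ')f - 𝒞ₐf', and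
elimination of f' gives exactly the reduced symplectic system. The matrix 𝓑 is invertible because
B⁻¹ is negative definite on 𝒟.

Trivial intersection (`disjoint_calK_calS`): an element of 𝒦 ∩ 𝒮 gives an almost everywhere solution
(f, φ) of the reduced system with f(a) = f(b) = 0. The coefficients are continuous, so the solution
is classical, and the absence of a focal instant at b forces f = 0.

Sum (`exists_mem_calS_sub_mem_calK`): given v, a section s = ∑ fⱼYⱼ with v - s in 𝒦 amounts to a
solution of the reduced system with an L² forcing term built from u and g, under the conditions f(a)
= f(b) = 0. By the Fredholm alternative for linear systems (`exists_boundary_value_solution`), this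
two point problem is solvable as soon as the homogeneous one has only the zero solution, which is
again the absence of focal instants.

Closedness: evaluation at a point is continuous on H¹, which settles 𝒮. For 𝒦, "u is a constant plus
the primitive of g" says that a bounded operator from H¹ to L¹ sends v into the line of constants,
and that line is closed. -/

theorem _root_.AbsolutelyContinuousOnInterval.congr {X : Type*} [PseudoMetricSpace X]
    {f g : ℝ → X} (hf : AbsolutelyContinuousOnInterval f a b) (h : EqOn f g (uIcc a b)) :
    AbsolutelyContinuousOnInterval g a b := by
  rw [absolutelyContinuousOnInterval_iff] at hf ⊢
  intro ε hε
  obtain ⟨δ, hδ, H⟩ := hf ε hε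
  refine ⟨δ, hδ, fun I hI hs => ?_⟩
  refine lt_of_eq_of_lt (Finset.sum_congr rfl fun i hi => ?_) (H I hI hs)
  rw [h (hI.1 i hi).1, h (hI.1 i hi).2]

theorem _root_.AbsolutelyContinuousOnInterval.lipschitz_comp {X Z : Type*} [PseudoMetricSpace X]
    [PseudoMetricSpace Z] {f : ℝ → X} {K : NNReal} {T : X → Z} (hT : LipschitzWith K T)
    (hf : AbsolutelyContinuousOnInterval f a b) :
    AbsolutelyContinuousOnInterval (fun t => T (f t)) a b := by
  rw [absolutelyContinuousOnInterval_iff] at hf ⊢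
  intro ε hε
  -- `K + 1` rather than `K`, since the Lipschitz constant may be 0.
  obtain ⟨δ, hδ, H⟩ := hf (ε / (K + 1)) (by positivity)
  refine ⟨δ, hδ, fun I hI hs => ?_⟩
  have h1 := H I hI hs
  rw [lt_div_iff₀ (by positivity)] at h1
  calc _ ≤ ∑ i ∈ Finset.range I.1, K * dist (f (I.2 i).1) (f (I.2 i).2) :=
        Finset.sum_le_sum fun i _ => hT.dist_le_mul _ _
    _ = K * ∑ i ∈ Finset.range I.1, dist (f (I.2 i).1) (f (I.2 i).2) := by rw [Finset.mul_sum]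
    _ ≤ (∑ i ∈ Finset.range I.1, dist (f (I.2 i).1) (f (I.2 i).2)) * (K + 1) := by
        have : 0 ≤ ∑ i ∈ Finset.range I.1, dist (f (I.2 i).1) (f (I.2 i).2) :=
          Finset.sum_nonneg fun _ _ => dist_nonneg
        nlinarith
    _ < ε := h1

/-- `f` is absolutely continuous on `[a,b]` and `g` is its derivative almost everywhere. -/
structure HasWeakDeriv (a b : ℝ) (f g : ℝ → E) : Prop where
  ac : AbsolutelyContinuousOnInterval f a b
  ae_deriv : ∀ᵐ t ∂(volume.restrict (Icc a b)), HasDerivWithinAt f (g t) (Icc a b) t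

namespace HasWeakDeriv

theorem congr {f g f₁ g₁ : ℝ → E} (hab : a < b) (h : HasWeakDeriv a b f g)
    (hf : EqOn f₁ f (Icc a b)) (hg : g₁ =ᵐ[volume.restrict (Icc a b)] g) :
    HasWeakDeriv a b f₁ g₁ := by
  refine ⟨h.ac.congr (by rw [uIcc_of_le hab.le]; exact hf.symm), ?_⟩
  filter_upwards [h.ae_deriv, hg, ae_restrict_mem measurableSet_Icc] with t h1 h2 ht
  rw [h2]
  exact h1.congr hf (hf ht)

theorem continuousOn {f g : ℝ → E} (hab : a < b) (h : HasWeakDeriv a b f g) :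
    ContinuousOn f (Icc a b) := by
  have := h.ac.continuousOn
  rwa [uIcc_of_le hab.le] at this

theorem derivWithin_ae {f g : ℝ → E} (hab : a < b) (h : HasWeakDeriv a b f g) :
    derivWithin f (Icc a b) =ᵐ[volume.restrict (Icc a b)] g := by
  filter_upwards [h.ae_deriv, ae_restrict_mem measurableSet_Icc] with t h1 ht
  exact h1.derivWithin (uniqueDiffOn_Icc hab t ht)

theorem add {f g f₁ g₁ : ℝ → E} (h : HasWeakDeriv a b f g) (h₁ : HasWeakDeriv a b f₁ g₁) :
    HasWeakDeriv a b (fun t => f t + f₁ t) (fun t => g t + g₁ t) := by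
  refine ⟨h.ac.add h₁.ac, ?_⟩
  filter_upwards [h.ae_deriv, h₁.ae_deriv] with t h1 h2 using h1.add h2

theorem neg {f g : ℝ → E} (h : HasWeakDeriv a b f g) :
    HasWeakDeriv a b (fun t => -f t) (fun t => -g t) := by
  refine ⟨h.ac.neg, ?_⟩
  filter_upwards [h.ae_deriv] with t h1 using h1.neg

theorem sub {f g f₁ g₁ : ℝ → E} (h : HasWeakDeriv a b f g) (h₁ : HasWeakDeriv a b f₁ g₁) :
    HasWeakDeriv a b (fun t => f t - f₁ t) (fun t => g t - g₁ t) := by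
  simpa only [sub_eq_add_neg] using h.add h₁.neg

theorem zero : HasWeakDeriv a b (fun _ => (0 : E)) (fun _ => 0) :=
  ⟨(LipschitzWith.const (0 : E)).lipschitzOnWith.absolutelyContinuousOnInterval,
    Filter.Eventually.of_forall fun t => hasDerivWithinAt_const t _ _⟩

theorem sum {ι : Type*} (s : Finset ι) {f g : ι → ℝ → E}
    (h : ∀ i ∈ s, HasWeakDeriv a b (f i) (g i)) :
    HasWeakDeriv a b (fun t => ∑ i ∈ s, f i t) (fun t => ∑ i ∈ s, g i t) := by
  classical
  induction s using Finset.induction_on with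
  | empty => simpa using zero
  | insert i s hi ih =>
    simp only [Finset.sum_insert hi]
    exact (h i (Finset.mem_insert_self i s)).add
      (ih fun j hj => h j (Finset.mem_insert_of_mem hj))

theorem smul {c c' : ℝ → ℝ} {f g : ℝ → E} (hc : HasWeakDeriv a b c c')
    (h : HasWeakDeriv a b f g) :
    HasWeakDeriv a b (fun t => c t • f t) (fun t => c t • g t + c' t • f t) := by
  refine ⟨hc.ac.smul h.ac, ?_⟩
  filter_upwards [hc.ae_deriv, h.ae_deriv] with t h1 h2 using h1.smul h2

theorem mul {c c' f g : ℝ → ℝ} (hc : HasWeakDeriv a b c c') (h : HasWeakDeriv a b f g) :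
    HasWeakDeriv a b (fun t => c t * f t) (fun t => c t * g t + c' t * f t) :=
  hc.smul h

theorem clm_comp {f g : ℝ → E} (T : E →L[ℝ] F) (h : HasWeakDeriv a b f g) :
    HasWeakDeriv a b (fun t => T (f t)) (fun t => T (g t)) := by
  refine ⟨h.ac.lipschitz_comp T.lipschitz, ?_⟩
  filter_upwards [h.ae_deriv] with t h1
  exact T.hasFDerivAt.comp_hasDerivWithinAt t h1

/-- A continuous derivative is bounded on the compact interval, so the function is Lipschitz and
hence absolutely continuous. -/
theorem of_classical {f g : ℝ → E} (hab : a < b) (hg : ContinuousOn g (Icc a b))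
    (h : ∀ t ∈ Icc a b, HasDerivWithinAt f (g t) (Icc a b) t) : HasWeakDeriv a b f g := by
  obtain ⟨M, hM⟩ := isCompact_Icc.exists_bound_of_continuousOn hg
  refine ⟨?_, (ae_restrict_iff' measurableSet_Icc).2 (Filter.Eventually.of_forall h)⟩
  have : LipschitzOnWith M.toNNReal f (uIcc a b) := by
    rw [uIcc_of_le hab.le]
    refine (convex_Icc a b).lipschitzOnWith_of_nnnorm_hasDerivWithin_le h fun t ht => ?_
    rw [← NNReal.coe_le_coe, coe_nnnorm]
    exact (hM t ht).trans (Real.le_coe_toNNReal M)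
  exact this.absolutelyContinuousOnInterval

theorem of_contDiffOn {f : ℝ → E} (hab : a < b) (h : ContDiffOn ℝ 1 f (Icc a b)) :
    HasWeakDeriv a b f (derivWithin f (Icc a b)) :=
  of_classical hab (h.continuousOn_derivWithin (uniqueDiffOn_Icc hab) le_rfl)
    fun _ ht => ((h.differentiableOn (by norm_num)) _ ht).hasDerivWithinAt

theorem ae_hasDerivAt {f g : ℝ → E} (h : HasWeakDeriv a b f g) :
    ∀ᵐ t, t ∈ Icc a b → HasDerivAt f (g t) t := by
  have h1 := (ae_restrict_iff' measurableSet_Icc).1 h.ae_deriv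
  have h2 : ∀ᵐ t : ℝ, t ≠ a := by simp [ae_iff]
  have h3 : ∀ᵐ t : ℝ, t ≠ b := by simp [ae_iff]
  filter_upwards [h1, h2, h3] with t h1 h2 h3 ht
  exact (h1 ht).hasDerivAt (Icc_mem_nhds (lt_of_le_of_ne ht.1 h2.symm) (lt_of_le_of_ne ht.2 h3))

theorem integral_eq_sub {f g : ℝ → ℝ} (h : HasWeakDeriv a b f g) {x y : ℝ}
    (hx : x ∈ Icc a b) (hy : y ∈ Icc a b) : ∫ t in x..y, g t = f y - f x := by
  have hsub : uIcc x y ⊆ uIcc a b := by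
    rw [uIcc_of_le (hx.1.trans hx.2)]
    exact uIcc_subset_Icc hx hy
  rw [← (h.ac.mono hsub).integral_deriv_eq_sub]
  refine intervalIntegral.integral_congr_ae ?_
  filter_upwards [h.ae_hasDerivAt] with t ht hm
  refine (ht ?_).deriv.symm
  exact uIcc_subset_Icc hx hy (uIoc_subset_uIcc hm)

theorem primitive {g : ℝ → ℝ} (hab : a < b) (hg : IntegrableOn g (Icc a b)) :
    HasWeakDeriv a b (fun t => ∫ s in a..t, g s) g := by
  have hi : IntervalIntegrable g volume a b :=
    (intervalIntegrable_iff_integrableOn_Icc_of_le hab.le).2 hg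
  refine ⟨hi.absolutelyContinuousOnInterval_intervalIntegral left_mem_uIcc, ?_⟩
  rw [ae_restrict_iff' measurableSet_Icc]
  filter_upwards [hi.ae_hasDerivAt_integral] with t ht hm
  rw [uIcc_of_le hab.le] at ht
  exact (ht hm a (left_mem_Icc.2 hab.le)).hasDerivWithinAt

/-- An absolutely continuous function whose derivative agrees almost everywhere with a continuous
function is continuously differentiable. -/
theorem hasDerivWithinAt {f g : ℝ → ℝ} (hab : a < b) (h : HasWeakDeriv a b f g)
    (hg : ContinuousOn g (Icc a b)) {t : ℝ} (ht : t ∈ Icc a b) :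
    HasDerivWithinAt f (g t) (Icc a b) t := by
  have hi : IntervalIntegrable g volume a t :=
    (hg.mono (by rw [uIcc_of_le ht.1]; exact Icc_subset_Icc_right ht.2)).intervalIntegrable
  -- The fundamental theorem of calculus within `Icc a b`, endpoints included, finds its filter
  -- instance through this `Fact`.
  have hfact : Fact (t ∈ Icc a b) := ⟨ht⟩
  have h1 : HasDerivWithinAt (fun u => ∫ x in a..u, g x) (g t) (Icc a b) t :=
    intervalIntegral.integral_hasDerivWithinAt_right hi
      (hg.stronglyMeasurableAtFilter_nhdsWithin measurableSet_Icc t) (hg t ht)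
  have h2 := h1.const_add (f a)
  refine h2.congr (fun u hu => ?_) ?_
  · rw [h.integral_eq_sub (left_mem_Icc.2 hab.le) hu]; ring
  · rw [h.integral_eq_sub (left_mem_Icc.2 hab.le) ht]; ring

end HasWeakDeriv

end WeakDeriv

/-! ### Passage between weak derivatives and H¹; Lᵖ functions under continuous coefficients -/

section MemH1

variable {E : Type*} [NormedAddCommGroup E] [InnerProductSpace ℝ E] [FiniteDimensional ℝ E]
variable {a b : ℝ}

theorem MemH1.hasWeakDeriv (hab : a < b) {v : ℝ → E} (hv : MemH1 a b v) :
    HasWeakDeriv a b v (derivWithin v (Icc a b)) :=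
  ⟨hv.1, hv.ae_hasDerivWithinAt hab⟩

theorem HasWeakDeriv.memH1 (hab : a < b) {v w : ℝ → E} (hv : HasWeakDeriv a b v w)
    (hw : MemLp w 2 (volume.restrict (Icc a b))) : MemH1 a b v :=
  ⟨hv.ac, (memLp_congr_ae (hv.derivWithin_ae hab)).2 hw⟩

theorem _root_.MeasureTheory.MemLp.clm_apply_of_continuousOn {E F : Type*}
    [NormedAddCommGroup E] [NormedSpace ℝ E] [NormedAddCommGroup F] [NormedSpace ℝ F]
    {p : ENNReal} {L : ℝ → E →L[ℝ] F} {w : ℝ → E} (hL : ContinuousOn L (Icc a b))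
    (hw : MemLp w p (volume.restrict (Icc a b))) :
    MemLp (fun t => L t (w t)) p (volume.restrict (Icc a b)) := by
  obtain ⟨M, hM⟩ := isCompact_Icc.exists_bound_of_continuousOn hL
  refine hw.of_le_mul (c := M)
    ((ContinuousLinearMap.id ℝ (E →L[ℝ] F)).aestronglyMeasurable_comp₂
      (hL.aestronglyMeasurable_of_isCompact isCompact_Icc measurableSet_Icc) hw.1) ?_
  rw [ae_restrict_iff' measurableSet_Icc]
  refine Filter.Eventually.of_forall fun t ht => ?_
  exact ((L t).le_opNorm _).trans (mul_le_mul_of_nonneg_right (hM t ht) (norm_nonneg _))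

theorem _root_.MeasureTheory.MemLp.continuousOn_mul {p : ENNReal} {c w : ℝ → ℝ}
    (hc : ContinuousOn c (Icc a b)) (hw : MemLp w p (volume.restrict (Icc a b))) :
    MemLp (fun t => c t * w t) p (volume.restrict (Icc a b)) := by
  have : ContinuousOn (fun t => c t • ContinuousLinearMap.id ℝ ℝ) (Icc a b) :=
    hc.smul continuousOn_const
  simpa using hw.clm_apply_of_continuousOn this

theorem _root_.ContinuousOn.memLp_Icc {F : Type*} [NormedAddCommGroup F] {p : ENNReal}
    {c : ℝ → F} (hc : ContinuousOn c (Icc a b)) : MemLp c p (volume.restrict (Icc a b)) := by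
  obtain ⟨M, hM⟩ := isCompact_Icc.exists_bound_of_continuousOn hc
  exact MemLp.of_bound (hc.aestronglyMeasurable_of_isCompact isCompact_Icc measurableSet_Icc) M
    ((ae_restrict_iff' measurableSet_Icc).2 (Filter.Eventually.of_forall hM))

theorem _root_.MeasureTheory.MemLp.integrableOn_Icc {w : ℝ → ℝ}
    (hw : MemLp w 2 (volume.restrict (Icc a b))) : IntegrableOn w (Icc a b) :=
  hw.integrable (by norm_num)

end MemH1

end SymplecticIndex

namespace SymplecticIndex

/-! ### Linear systems: global existence, regularity, two point boundary value problems -/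

section LinearODE

variable {ι κ : Type*} [Fintype ι] [Fintype κ] {a b : ℝ}

/-- The nearest point retraction of `ℝ^ι`, with the supremum norm, onto the ball of radius `N`. -/
def clamp (N : ℝ) (x : ι → ℝ) (i : ι) : ℝ := max (-N) (min N (x i))

theorem lipschitzWith_clamp (N : ℝ) : LipschitzWith 1 (clamp N : (ι → ℝ) → ι → ℝ) := by
  refine LipschitzWith.of_dist_le_mul fun x y => ?_
  rw [NNReal.coe_one, one_mul, dist_pi_le_iff dist_nonneg]
  intro i
  refine le_trans ?_ (dist_le_pi_dist x y i)
  have h := ((LipschitzWith.id (α := ℝ)).const_min N).const_max (-N)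
  simpa [clamp] using h.dist_le_mul (x i) (y i)

theorem norm_clamp_le {N : ℝ} (hN : 0 ≤ N) (x : ι → ℝ) : ‖clamp N x‖ ≤ N := by
  rw [pi_norm_le_iff_of_nonneg hN]
  intro i
  rw [Real.norm_eq_abs, abs_le]
  exact ⟨le_max_left _ _, max_le (by linarith) (min_le_left _ _)⟩

theorem clamp_of_norm_le {N : ℝ} {x : ι → ℝ} (hx : ‖x‖ ≤ N) : clamp N x = x := by
  funext i
  have h := abs_le.1 ((norm_le_pi_norm x i).trans hx)
  rw [clamp, min_eq_right h.2, max_eq_right h.1]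

theorem norm_clamp_le_norm {N : ℝ} (hN : 0 ≤ N) (x : ι → ℝ) : ‖clamp N x‖ ≤ ‖x‖ := by
  have h := (lipschitzWith_clamp N).dist_le_mul x 0
  rw [clamp_of_norm_le (x := (0 : ι → ℝ)) (by simpa using hN)] at h
  simpa using h

/-- Initial value problems for globally Lipschitz vector fields have global solutions. -/
theorem exists_hasDerivWithinAt_of_lipschitzWith (hab : a ≤ b) {F : ℝ → (ι → ℝ) → ι → ℝ}
    {K : NNReal} (hL : ∀ t ∈ Icc a b, LipschitzWith K (F t))
    (hc : ∀ x, ContinuousOn (fun t => F t x) (Icc a b)) (x₀ : ι → ℝ) :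
    ∃ z : ℝ → ι → ℝ, z a = x₀ ∧
      ∀ t ∈ Icc a b, HasDerivWithinAt z (F t (z t)) (Icc a b) t := by
  obtain ⟨c, hc0⟩ := isCompact_Icc.exists_bound_of_continuousOn (hc 0)
  have hcnn : 0 ≤ c := (norm_nonneg _).trans (hc0 a (left_mem_Icc.2 hab))
  have hF : ∀ t ∈ Icc a b, ∀ x, ‖F t x‖ ≤ K * ‖x‖ + c := fun t ht x => by
    have h1 := (hL t ht).dist_le_mul x 0
    rw [dist_eq_norm, dist_zero_right] at h1
    have h2 := norm_le_norm_sub_add (F t x) (F t 0)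
    linarith [hc0 t ht]
  -- The a priori Grönwall bound for solutions of the original equation. The truncated field obeys
  -- the same linear growth estimate, so its solution stays in the ball of radius `N`, where the
  -- truncation does nothing.
  set N : ℝ := max 0 (gronwallBound ‖x₀‖ K c (b - a))
  have hN : 0 ≤ N := le_max_left _ _
  have hlip : ∀ t ∈ Icc a b, LipschitzWith K fun x => F t (clamp N x) := fun t ht => by
    simpa [Function.comp_def] using (hL t ht).comp (lipschitzWith_clamp N)
  -- A uniform bound for the truncated field. With radius `L * (b - a)` the Picard–Lindelöf time
  -- condition holds on the whole interval.
  set L : NNReal := ⟨K * N + c, by positivity⟩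
  have hpl : IsPicardLindelof (fun t x => F t (clamp N x))
      (⟨a, left_mem_Icc.2 hab⟩ : Icc a b) x₀ (L * (b - a).toNNReal) 0 L K := by
    refine ⟨fun t ht => (hlip t ht).lipschitzOnWith, fun x _ => hc _, fun t ht x _ => ?_, ?_⟩
    · refine (hF t ht _).trans ?_
      change _ ≤ K * N + c
      gcongr
      exact norm_clamp_le hN x
    · simp [hab]
  obtain ⟨z, hz0, hz⟩ := hpl.exists_eq_forall_mem_Icc_hasDerivWithinAt₀
  refine ⟨z, hz0, fun t ht => ?_⟩
  have hbound := norm_le_gronwallBound_of_norm_deriv_right_le (f := z)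
    (f' := fun t => F t (clamp N (z t))) (δ := ‖x₀‖) (K := K) (ε := c)
    (fun t ht => (hz t ht).continuousWithinAt)
    (fun t ht => (hz t (Ico_subset_Icc_self ht)).mono_of_mem_nhdsWithin
      (Icc_mem_nhdsGE_of_mem ht)) (by simp [← hz0])
    (fun t ht => (hF t (Ico_subset_Icc_self ht) _).trans (by
      gcongr; exact norm_clamp_le_norm hN _)) t ht
  have h1 : ‖z t‖ ≤ N := hbound.trans ((gronwallBound_mono (norm_nonneg _) hcnn K.2
    (sub_le_sub_right ht.2 a)).trans (le_max_right _ _))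
  simpa [clamp_of_norm_le h1] using hz t ht

theorem continuousOn_mulVec {μ : Type*} {N : ℝ → Matrix μ ι ℝ} {x : ℝ → ι → ℝ} {s : Set ℝ}
    (hN : ∀ i j, ContinuousOn (fun t => N t i j) s) (hx : ContinuousOn x s) :
    ContinuousOn (fun t => (N t).mulVec (x t)) s :=
  continuousOn_pi.2 fun i => continuousOn_finsetSum _ fun j _ =>
    (hN i j).mul (continuousOn_pi.1 hx j)

theorem exists_hasDerivWithinAt_mulVec_add (hab : a ≤ b) {N : ℝ → Matrix ι ι ℝ}
    (hN : ∀ i j, ContinuousOn (fun t => N t i j) (Icc a b)) {c : ℝ → ι → ℝ}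
    (hc : ContinuousOn c (Icc a b)) (x₀ : ι → ℝ) :
    ∃ z : ℝ → ι → ℝ, z a = x₀ ∧
      ∀ t ∈ Icc a b, HasDerivWithinAt z ((N t).mulVec (z t) + c t) (Icc a b) t := by
  choose M hM using fun i j => isCompact_Icc.exists_bound_of_continuousOn (hN i j)
  have hM0 : ∀ i j, 0 ≤ M i j := fun i j =>
    (norm_nonneg _).trans (hM i j a (left_mem_Icc.2 hab))
  refine exists_hasDerivWithinAt_of_lipschitzWith hab (F := fun t x => (N t).mulVec x + c t)
    (K := ⟨∑ i, ∑ j, M i j, Finset.sum_nonneg fun i _ => Finset.sum_nonneg fun j _ => hM0 i j⟩)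
    (fun t ht => LipschitzWith.of_dist_le_mul fun x y => ?_)
    (fun x => (continuousOn_mulVec hN continuousOn_const).add hc) x₀
  rw [dist_add_right, dist_eq_norm, ← Matrix.mulVec_sub, dist_eq_norm]
  change _ ≤ (∑ i, ∑ j, M i j) * _
  rw [pi_norm_le_iff_of_nonneg (mul_nonneg
    (Finset.sum_nonneg fun i _ => Finset.sum_nonneg fun j _ => hM0 i j) (norm_nonneg _))]
  intro i
  calc ‖∑ j, N t i j * (x - y) j‖ ≤ ∑ j, M i j * ‖x - y‖ := by
        refine (norm_sum_le _ _).trans (Finset.sum_le_sum fun j _ => ?_)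
        rw [norm_mul]
        exact mul_le_mul (hM i j t ht) (norm_le_pi_norm _ j) (norm_nonneg _) (hM0 i j)
    _ = (∑ j, M i j) * ‖x - y‖ := by rw [Finset.sum_mul]
    _ ≤ _ := mul_le_mul_of_nonneg_right (Finset.single_le_sum (f := fun i => ∑ j, M i j)
          (fun i _ => Finset.sum_nonneg fun j _ => hM0 i j) (Finset.mem_univ i)) (norm_nonneg _)

/-- Solutions in the almost everywhere sense of a linear system with continuous coefficients are
classical. -/
theorem hasDerivWithinAt_of_hasWeakDeriv_mulVec (hab : a < b) {N : ℝ → Matrix ι ι ℝ}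
    (hN : ∀ i j, ContinuousOn (fun t => N t i j) (Icc a b)) {z : ℝ → ι → ℝ}
    (hz : ∀ i, HasWeakDeriv a b (fun t => z t i) (fun t => (N t).mulVec (z t) i)) :
    ∀ t ∈ Icc a b, HasDerivWithinAt z ((N t).mulVec (z t)) (Icc a b) t := by
  have hzc : ContinuousOn z (Icc a b) := continuousOn_pi.2 fun i => (hz i).continuousOn hab
  exact fun t ht => hasDerivWithinAt_pi.2 fun i =>
    (hz i).hasDerivWithinAt hab (continuousOn_pi.1 (continuousOn_mulVec hN hzc) i) ht

/-- Solvability of the inhomogeneous two point boundary value problem `z₁(a) = z₁(b) = 0` for a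
linear system whose homogeneous problem has only the trivial solution. -/
theorem exists_boundary_value_solution [DecidableEq κ] (hab : a < b)
    {N : ℝ → Matrix (κ ⊕ κ) (κ ⊕ κ) ℝ}
    (hN : ∀ i j, ContinuousOn (fun t => N t i j) (Icc a b))
    (hinj : ∀ z : ℝ → κ ⊕ κ → ℝ,
      (∀ t ∈ Icc a b, HasDerivWithinAt z ((N t).mulVec (z t)) (Icc a b) t) →
      (∀ i, z a (Sum.inl i) = 0) → (∀ i, z b (Sum.inl i) = 0) → ∀ i, z a (Sum.inr i) = 0)
    {r : ℝ → κ ⊕ κ → ℝ} (hr : ∀ i, IntegrableOn (fun t => r t i) (Icc a b)) :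
    ∃ z : ℝ → κ ⊕ κ → ℝ, (∀ i, z a (Sum.inl i) = 0) ∧ (∀ i, z b (Sum.inl i) = 0) ∧
      ∀ i, HasWeakDeriv a b (fun t => z t i) (fun t => (N t).mulVec (z t) i + r t i) := by
  -- The forcing `r` is only integrable. Its primitive is continuous, and if w' = Nw + NR, then w +
  -- R solves the equation with forcing `r`; thus only continuous forcing meets the classical
  -- theory.
  set R : ℝ → κ ⊕ κ → ℝ := fun t i => ∫ s in a..t, r s i with hR
  have hRw : ∀ i, HasWeakDeriv a b (fun t => R t i) (fun t => r t i) := fun i =>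
    HasWeakDeriv.primitive hab (hr i)
  have hRc : ContinuousOn R (Icc a b) := continuousOn_pi.2 fun i => (hRw i).continuousOn hab
  obtain ⟨w, hw0, hw⟩ := exists_hasDerivWithinAt_mulVec_add hab.le hN
    (continuousOn_mulVec hN hRc) 0
  -- The homogeneous solutions with initial value (0, eⱼ); their combinations are the available
  -- corrections that keep z₁(a) = 0.
  choose Z hZ0 hZ using fun j : κ => exists_hasDerivWithinAt_mulVec_add hab.le hN
    (c := fun _ => 0) continuousOn_const (Pi.single (Sum.inr j) 1)
  have hcomb : ∀ (c : κ → ℝ), ∀ t ∈ Icc a b,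
      HasDerivWithinAt (fun t => ∑ j, c j • Z j t)
        ((N t).mulVec (∑ j, c j • Z j t)) (Icc a b) t := fun c t ht => by
    have := HasDerivWithinAt.fun_sum (u := Finset.univ) fun j _ =>
      (hZ j t ht).const_smul (c j)
    rw [Matrix.mulVec_sum]
    simpa [Matrix.mulVec_smul] using this
  have hcomb0 : ∀ (c : κ → ℝ) i, (∑ j, c j • Z j a) (Sum.inl i) = 0 := fun c i => by
    simp [hZ0, Finset.sum_apply]
  have hcomb1 : ∀ (c : κ → ℝ) i, (∑ j, c j • Z j a) (Sum.inr i) = c i := fun c i => by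
    simp [hZ0, Finset.sum_apply, Pi.single_apply]
  -- The shooting map, from the initial value of z₂ to the final value of z₁. It is a square matrix,
  -- so injectivity gives the surjectivity needed to cancel z₁(b).
  let T : (κ → ℝ) →ₗ[ℝ] κ → ℝ := (Matrix.of fun i j => Z j b (Sum.inl i)).mulVecLin
  have hT : ∀ c i, T c i = (∑ j, c j • Z j b) (Sum.inl i) := fun c i => by
    simp [T, Matrix.mulVec, dotProduct, Finset.sum_apply, mul_comm]
  have hTinj : Function.Injective T := by
    rw [injective_iff_map_eq_zero]
    intro c hc
    funext i
    rw [← hcomb1 c i]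
    exact hinj _ (hcomb c) (hcomb0 c) (fun i => by rw [← hT, hc]; rfl) i
  obtain ⟨c, hc⟩ := LinearMap.injective_iff_surjective.1 hTinj
    (fun i => -(w b (Sum.inl i) + R b (Sum.inl i)))
  refine ⟨fun t => w t + R t + ∑ j, c j • Z j t, fun i => ?_, fun i => ?_, fun i => ?_⟩
  · change (w a + R a) _ + (∑ j, c j • Z j a) _ = 0
    rw [hcomb0, Pi.add_apply, hw0]
    simp [hR]
  · change (w b + R b) _ + (∑ j, c j • Z j b) _ = 0
    rw [← hT, hc, Pi.add_apply]
    ring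
  · have hwc : ContinuousOn w (Icc a b) := fun t ht => (hw t ht).continuousWithinAt
    have hcc : ContinuousOn (fun t => ∑ j, c j • Z j t) (Icc a b) := fun t ht =>
      (hcomb c t ht).continuousWithinAt
    have h1 : HasWeakDeriv a b (fun t => w t i)
        (fun t => ((N t).mulVec (w t) + (N t).mulVec (R t)) i) :=
      HasWeakDeriv.of_classical hab
        (continuousOn_pi.1 ((continuousOn_mulVec hN hwc).add (continuousOn_mulVec hN hRc)) i)
        fun t ht => hasDerivWithinAt_pi.1 (hw t ht) i
    have h2 : HasWeakDeriv a b (fun t => (∑ j, c j • Z j t) i)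
        (fun t => (N t).mulVec (∑ j, c j • Z j t) i) :=
      HasWeakDeriv.of_classical hab
        (continuousOn_pi.1 (continuousOn_mulVec hN hcc) i)
        fun t ht => hasDerivWithinAt_pi.1 (hcomb c t ht) i
    refine ((h1.add (hRw i)).add h2).congr hab (fun t _ => rfl)
      (Filter.Eventually.of_forall fun t => ?_)
    simp only [Matrix.mulVec_add, Pi.add_apply]
    ring

end LinearODE

end SymplecticIndex

namespace SymplecticIndex

/-! ### Bounded operators on H¹ and closedness of first order conditions -/

section

variable {E : Type*} [NormedAddCommGroup E] [InnerProductSpace ℝ E] [FiniteDimensional ℝ E]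
variable {a b : ℝ} {hab : a < b}

theorem intervalIntegral_congr_of_ae_restrict {f g : ℝ → ℝ}
    (hfg : f =ᵐ[volume.restrict (Icc a b)] g) {t : ℝ} (ht : t ∈ Icc a b) :
    ∫ s in a..t, f s = ∫ s in a..t, g s := by
  refine intervalIntegral.integral_congr_ae ?_
  filter_upwards [(ae_restrict_iff' measurableSet_Icc).1 hfg] with s hs hm
  rw [uIoc_of_le ht.1] at hm
  exact hs ⟨hm.1.le, hm.2.trans ht.2⟩

theorem norm_toLp_one {μ : Measure ℝ} {f : ℝ → ℝ} (hf : MemLp f 1 μ) :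
    ‖hf.toLp f‖ = ∫ t, ‖f t‖ ∂μ :=
  L1.norm_of_fun_eq_integral_norm (memLp_one_iff_integrable.1 hf)

namespace H1

theorem norm_toL2 (v : H1 E hab) : ‖toL2 E hab v‖ = ‖v‖ := by
  have h : ‖toL2 E hab v‖ ^ 2 = ‖v‖ ^ 2 := by
    rw [← real_inner_self_eq_norm_sq, ← real_inner_self_eq_norm_sq, inner_eq]
  exact (sq_eq_sq₀ (norm_nonneg _) (norm_nonneg _)).1 h

theorem hasWeakDeriv (v : H1 E hab) : HasWeakDeriv a b v.fn v.deriv :=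
  v.memH1.hasWeakDeriv hab

/-- Hölder on an interval of finite measure: the L¹ norm is bounded by the L² norm. All later
estimates on H¹ go through L¹. -/
theorem exists_integral_norm_le (E : Type*) [NormedAddCommGroup E] [InnerProductSpace ℝ E]
    [FiniteDimensional ℝ E] (hab : a < b) :
    ∃ C : ℝ, ∀ v : H1 E hab, (∫ t in Icc a b, ‖v.fn t‖) ≤ C * ‖v‖ ∧
      (∫ t in Icc a b, ‖v.deriv t‖) ≤ C * ‖v‖ := by
  set μ := volume.restrict (Icc a b)
  set c : ENNReal := μ Set.univ ^ (1 / (1 : ENNReal).toReal - 1 / (2 : ENNReal).toReal) with hc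
  have hctop : c ≠ ⊤ := ENNReal.rpow_ne_top_of_nonneg (by norm_num) (measure_ne_top μ _)
  have key : ∀ (w : ℝ → E) (hw : MemLp w 2 μ), ∫ t, ‖w t‖ ∂μ ≤ ‖hw.toLp w‖ * c.toReal := by
    intro w hw
    have h1 : MemLp w 1 μ := hw.mono_exponent (by norm_num)
    rw [integral_norm_eq_lintegral_enorm hw.1, ← eLpNorm_one_eq_lintegral_enorm,
      Lp.norm_toLp, ← ENNReal.toReal_mul]
    exact ENNReal.toReal_mono (ENNReal.mul_ne_top hw.2.ne hctop)
      (eLpNorm_le_eLpNorm_mul_rpow_measure_univ (by norm_num) hw.1)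
  refine ⟨c.toReal, fun v => ⟨?_, ?_⟩⟩
  · refine (key _ (v.memH1.memLp hab)).trans ?_
    rw [mul_comm, ← norm_toL2 v]
    exact mul_le_mul_of_nonneg_left (WithLp.norm_fst_le _ (toL2 E hab v)) ENNReal.toReal_nonneg
  · refine (key _ v.memH1.2).trans ?_
    rw [mul_comm, ← norm_toL2 v]
    exact mul_le_mul_of_nonneg_left (WithLp.norm_snd_le _ (toL2 E hab v)) ENNReal.toReal_nonneg

theorem integrable_deriv (v : H1 E hab) : IntegrableOn v.deriv (Icc a b) :=
  v.memH1.2.integrable (by norm_num)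

theorem integrable_fn (v : H1 E hab) : IntegrableOn v.fn (Icc a b) :=
  (v.memH1.memLp hab).integrable (by norm_num)

theorem norm_sub_le_integral (v : H1 E hab) {x y : ℝ} (hx : x ∈ Icc a b) (hy : y ∈ Icc a b) :
    ‖v.fn y - v.fn x‖ ≤ ∫ t in Icc a b, ‖v.deriv t‖ := by
  -- Pairing with `d` itself reduces the vector inequality to the scalar fundamental theorem: ‖d‖² =
  -- ∫⟨d, v'⟩ ≤ ‖d‖ ∫‖v'‖, up to orientation.
  set d := v.fn y - v.fn x
  have h := (v.hasWeakDeriv.clm_comp (innerSL ℝ d)).integral_eq_sub hx hy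
  have h2 : (innerSL ℝ d) (v.fn y) - (innerSL ℝ d) (v.fn x) = ‖d‖ * ‖d‖ := by
    rw [← map_sub, innerSL_apply_apply, real_inner_self_eq_norm_mul_norm]
  have hI : 0 ≤ ∫ t in Icc a b, ‖v.deriv t‖ := integral_nonneg fun _ => norm_nonneg _
  have hsub : uIoc x y ⊆ Icc a b := uIoc_subset_uIcc.trans (uIcc_subset_Icc hx hy)
  have h3 : ‖d‖ * ‖d‖ ≤ ‖d‖ * ∫ t in Icc a b, ‖v.deriv t‖ := by
    rw [← h2, ← h]
    refine (le_abs_self _).trans ?_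
    rw [← Real.norm_eq_abs]
    refine intervalIntegral.norm_integral_le_integral_norm_uIoc.trans ?_
    rw [← integral_const_mul]
    have hint : IntegrableOn (fun t => ‖d‖ * ‖v.deriv t‖) (Icc a b) :=
      v.integrable_deriv.norm.const_mul _
    refine le_trans ?_ (setIntegral_mono_set hint
      (Filter.Eventually.of_forall fun t => by positivity) hsub.eventuallyLE)
    refine setIntegral_mono ?_ (hint.mono_set hsub) fun t => ?_
    · exact (((innerSL ℝ d).integrable_comp v.integrable_deriv).norm).mono_measure
        (Measure.restrict_mono hsub le_rfl)
    · exact norm_inner_le_norm _ _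
  rcases (norm_nonneg d).eq_or_lt with h0 | h0
  · rw [← h0]; exact hI
  · exact le_of_mul_le_mul_left h3 h0

/-- Evaluation at a point of `[a,b]` is continuous on `H¹`. -/
theorem continuous_eval {t : ℝ} (ht : t ∈ Icc a b) : Continuous fun v : H1 E hab => v.fn t := by
  obtain ⟨C, hC⟩ := exists_integral_norm_le E hab
  let T : H1 E hab →ₗ[ℝ] E :=
    { toFun := fun v => v.fn t, map_add' := fun _ _ => rfl, map_smul' := fun _ _ => rfl }
  refine (T.mkContinuous ((b - a)⁻¹ * (C + (b - a) * C)) fun v => ?_).continuous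
  change ‖v.fn t‖ ≤ _
  have hba : 0 < b - a := sub_pos.2 hab
  -- Integrate ‖v(t)‖ ≤ ‖v(s)‖ + ∫‖v'‖ over s in [a,b].
  have h1 : (b - a) * ‖v.fn t‖ ≤
      (∫ s in Icc a b, ‖v.fn s‖) + (b - a) * ∫ s in Icc a b, ‖v.deriv s‖ := by
    have hvol : volume.real (Icc a b) = b - a := by simp [Measure.real, hab.le]
    have e1 : (b - a) * ‖v.fn t‖ = ∫ s in Icc a b, ‖v.fn t‖ := by
      rw [setIntegral_const, hvol, smul_eq_mul]
    have e2 : (∫ s in Icc a b, ‖v.fn s‖) + (b - a) * ∫ s in Icc a b, ‖v.deriv s‖ =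
        ∫ s in Icc a b, (‖v.fn s‖ + ∫ s in Icc a b, ‖v.deriv s‖) := by
      rw [integral_add v.integrable_fn.norm (integrable_const _), setIntegral_const, hvol,
        smul_eq_mul]
    rw [e1, e2]
    refine setIntegral_mono_on (integrable_const _)
      (v.integrable_fn.norm.add (integrable_const _)) measurableSet_Icc fun s hs => ?_
    have := norm_sub_le_integral v hs ht
    linarith [norm_le_norm_sub_add (v.fn t) (v.fn s)]
  rw [mul_assoc, le_inv_mul_iff₀ hba]
  refine h1.trans ?_
  rw [add_mul, mul_assoc]
  gcongr
  · exact (hC v).1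
  · exact (hC v).2

theorem memLp_firstOrder {p q : ℝ → StrongDual ℝ E} (hp : ContinuousOn p (Icc a b))
    (hq : ContinuousOn q (Icc a b)) (v : H1 E hab) :
    MemLp (fun t => p t (v.deriv t) + q t (v.fn t)) 2 (volume.restrict (Icc a b)) :=
  (v.memH1.2.clm_apply_of_continuousOn hp).add
    ((v.memH1.memLp hab).clm_apply_of_continuousOn hq)

/-- First order differential operators with continuous coefficients are bounded from `H¹` to
`L¹`. -/
theorem exists_firstOrder_clm (hab : a < b) {p q : ℝ → StrongDual ℝ E}
    (hp : ContinuousOn p (Icc a b)) (hq : ContinuousOn q (Icc a b)) :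
    ∃ T : H1 E hab →L[ℝ] Lp ℝ 1 (volume.restrict (Icc a b)), ∀ v,
      T v =ᵐ[volume.restrict (Icc a b)] fun t => p t (v.deriv t) + q t (v.fn t) := by
  have hL : ∀ v : H1 E hab, MemLp (fun t => p t (v.deriv t) + q t (v.fn t)) 1
      (volume.restrict (Icc a b)) := fun v => (memLp_firstOrder hp hq v).mono_exponent (by norm_num)
  obtain ⟨C, hC⟩ := exists_integral_norm_le E hab
  obtain ⟨M, hM⟩ := isCompact_Icc.exists_bound_of_continuousOn hp
  obtain ⟨M', hM'⟩ := isCompact_Icc.exists_bound_of_continuousOn hq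
  have hM0 : 0 ≤ M := (norm_nonneg _).trans (hM a (left_mem_Icc.2 hab.le))
  have hM'0 : 0 ≤ M' := (norm_nonneg _).trans (hM' a (left_mem_Icc.2 hab.le))
  let T : H1 E hab →ₗ[ℝ] Lp ℝ 1 (volume.restrict (Icc a b)) :=
    { toFun := fun v => (hL v).toLp _
      map_add' := fun v w => by
        rw [← MemLp.toLp_add]
        refine MemLp.toLp_congr _ _ ?_
        filter_upwards [v.memH1.ae_derivWithin_add hab w.memH1] with t ht
        have : (v + w).deriv t = v.deriv t + w.deriv t := ht
        rw [this, fn_add]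
        simp only [Pi.add_apply, map_add]
        ring
      map_smul' := fun c v => by
        rw [RingHom.id_apply, ← MemLp.toLp_const_smul]
        refine MemLp.toLp_congr _ _ ?_
        filter_upwards [v.memH1.ae_derivWithin_smul hab c] with t ht
        have : (c • v).deriv t = c • v.deriv t := ht
        rw [this, fn_smul]
        simp only [Pi.smul_apply, map_smul, smul_add] }
  refine ⟨T.mkContinuous (M * C + M' * C) fun v => ?_, fun v => MemLp.coeFn_toLp (hL v)⟩
  change ‖(hL v).toLp _‖ ≤ _
  rw [norm_toLp_one]
  calc _ ≤ ∫ t in Icc a b, (M * ‖v.deriv t‖ + M' * ‖v.fn t‖) := by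
        refine setIntegral_mono_on ((hL v).integrable le_rfl).norm
          ((v.integrable_deriv.norm.const_mul _).add (v.integrable_fn.norm.const_mul _))
          measurableSet_Icc fun t ht => ?_
        refine (norm_add_le _ _).trans (add_le_add ?_ ?_)
        · exact ((p t).le_opNorm _).trans (mul_le_mul_of_nonneg_right (hM t ht) (norm_nonneg _))
        · exact ((q t).le_opNorm _).trans (mul_le_mul_of_nonneg_right (hM' t ht) (norm_nonneg _))
    _ = M * (∫ t in Icc a b, ‖v.deriv t‖) + M' * ∫ t in Icc a b, ‖v.fn t‖ := by
        rw [integral_add (v.integrable_deriv.norm.const_mul _)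
          (v.integrable_fn.norm.const_mul _), integral_const_mul, integral_const_mul]
    _ ≤ M * (C * ‖v‖) + M' * (C * ‖v‖) := by
        gcongr
        · exact (hC v).2
        · exact (hC v).1
    _ = _ := by ring

end H1

/-- The Volterra operator `f ↦ ∫ₐᵗ f` is bounded on `L¹`. -/
theorem exists_volterra_clm (hab : a < b) :
    ∃ V : Lp ℝ 1 (volume.restrict (Icc a b)) →L[ℝ] Lp ℝ 1 (volume.restrict (Icc a b)), ∀ f,
      V f =ᵐ[volume.restrict (Icc a b)] fun t => ∫ s in a..t, f s := by
  have hint : ∀ f : Lp ℝ 1 (volume.restrict (Icc a b)), IntegrableOn f (Icc a b) := fun f =>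
    L1.integrable_coeFn f
  have hii : ∀ (f : Lp ℝ 1 (volume.restrict (Icc a b))), ∀ t ∈ Icc a b,
      IntervalIntegrable f volume a t := fun f t ht =>
    (intervalIntegrable_iff_integrableOn_Icc_of_le ht.1).2
      ((hint f).mono_set (Icc_subset_Icc_right ht.2))
  have hV : ∀ f : Lp ℝ 1 (volume.restrict (Icc a b)),
      MemLp (fun t => ∫ s in a..t, f s) 1 (volume.restrict (Icc a b)) := fun f =>
    ((HasWeakDeriv.primitive hab (hint f)).continuousOn hab).memLp_Icc
  let T : Lp ℝ 1 (volume.restrict (Icc a b)) →ₗ[ℝ] Lp ℝ 1 (volume.restrict (Icc a b)) :=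
    { toFun := fun f => (hV f).toLp _
      map_add' := fun f g => by
        rw [← MemLp.toLp_add]
        refine MemLp.toLp_congr _ _ ?_
        rw [Filter.EventuallyEq, ae_restrict_iff' measurableSet_Icc]
        refine Filter.Eventually.of_forall fun t ht => ?_
        rw [intervalIntegral_congr_of_ae_restrict (Lp.coeFn_add f g) ht]
        exact intervalIntegral.integral_add (hii f t ht) (hii g t ht)
      map_smul' := fun c f => by
        rw [RingHom.id_apply, ← MemLp.toLp_const_smul]
        refine MemLp.toLp_congr _ _ ?_
        rw [Filter.EventuallyEq, ae_restrict_iff' measurableSet_Icc]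
        refine Filter.Eventually.of_forall fun t ht => ?_
        rw [intervalIntegral_congr_of_ae_restrict (Lp.coeFn_smul c f) ht]
        exact intervalIntegral.integral_smul c f }
  refine ⟨T.mkContinuous (b - a) fun f => ?_, fun f => MemLp.coeFn_toLp (hV f)⟩
  change ‖(hV f).toLp _‖ ≤ _
  rw [norm_toLp_one]
  have hvol : volume.real (Icc a b) = b - a := by simp [Measure.real, hab.le]
  calc _ ≤ ∫ t in Icc a b, ‖f‖ := by
        refine setIntegral_mono_on ((hV f).integrable le_rfl).norm (integrable_const _)
          measurableSet_Icc fun t ht => ?_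
        refine intervalIntegral.norm_integral_le_integral_norm_uIoc.trans ?_
        rw [L1.norm_eq_integral_norm]
        refine setIntegral_mono_set (hint f).norm
          (Filter.Eventually.of_forall fun _ => norm_nonneg _) ?_
        rw [uIoc_of_le ht.1]
        exact (Ioc_subset_Icc_self.trans (Icc_subset_Icc_right ht.2)).eventuallyLE
    _ = _ := by rw [setIntegral_const, hvol, smul_eq_mul]

/-- The `H¹` functions for which one first order expression is, up to a constant, a primitive of
another one form a closed set. -/
theorem isClosed_setOf_firstOrder_eq_primitive (hab : a < b) {p q p' q' : ℝ → StrongDual ℝ E}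
    (hp : ContinuousOn p (Icc a b)) (hq : ContinuousOn q (Icc a b))
    (hp' : ContinuousOn p' (Icc a b)) (hq' : ContinuousOn q' (Icc a b)) :
    IsClosed {v : H1 E hab | ∃ c : ℝ, ∀ᵐ t ∂(volume.restrict (Icc a b)),
      p t (v.deriv t) + q t (v.fn t) =
        c + ∫ s in a..t, (p' s (v.deriv s) + q' s (v.fn s))} := by
  set μ := volume.restrict (Icc a b)
  obtain ⟨T, hT⟩ := H1.exists_firstOrder_clm hab hp hq
  obtain ⟨T', hT'⟩ := H1.exists_firstOrder_clm hab hp' hq'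
  obtain ⟨V, hV⟩ := exists_volterra_clm hab
  have h1 : MemLp (fun _ : ℝ => (1 : ℝ)) 1 μ := memLp_const 1
  -- The line of constant functions, closed because finite dimensional. The set in question is its
  -- preimage under `T - V ∘L T'`, with `V` the Volterra operator; the unknown constant `c` is the
  -- coordinate on this line.
  set W : Submodule ℝ (Lp ℝ 1 μ) := Submodule.span ℝ {h1.toLp _}
  have hW : IsClosed (W : Set (Lp ℝ 1 μ)) := W.closed_of_finiteDimensional
  convert hW.preimage (T - V ∘L T').continuous using 1
  ext v
  rw [mem_ofPred_eq, mem_preimage, SetLike.mem_coe, Submodule.mem_span_singleton]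
  refine exists_congr fun c => ?_
  rw [Lp.ext_iff]
  have e2 : ∀ᵐ t ∂μ, (T - V ∘L T') v t =
      p t (v.deriv t) + q t (v.fn t) - ∫ s in a..t, (p' s (v.deriv s) + q' s (v.fn s)) := by
    have h := Lp.coeFn_sub (T v) (V (T' v))
    filter_upwards [h, hT v, hV (T' v), ae_restrict_mem measurableSet_Icc] with t h hT hV ht
    have : (T - V ∘L T') v = T v - V (T' v) := rfl
    rw [this, h, Pi.sub_apply, hT, hV, intervalIntegral_congr_of_ae_restrict (hT' v) ht]
  have e1 : ∀ᵐ t ∂μ, (c • h1.toLp (fun _ : ℝ => (1 : ℝ)) : Lp ℝ 1 μ) t = c := by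
    filter_upwards [Lp.coeFn_smul c (h1.toLp _), MemLp.coeFn_toLp h1] with t h h'
    rw [h, Pi.smul_apply, h', smul_eq_mul, mul_one]
  constructor
  · intro h
    filter_upwards [h, e1, e2] with t h e1 e2
    rw [e1, e2, h]; ring
  · intro h
    filter_upwards [h, e1, e2] with t h e1 e2
    rw [e1, e2] at h
    rw [h]; ring

end

end SymplecticIndex

namespace SymplecticIndex

/-! ### Elements of H¹ from functions on the line; smoothness of inverse matrices -/

section Constructions

variable {E : Type*} [NormedAddCommGroup E] [InnerProductSpace ℝ E] [FiniteDimensional ℝ E]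
variable {a b : ℝ}

namespace H1

/-- The element of `H¹` given by a function on the line. -/
def ofMemH1 (hab : a < b) {s : ℝ → E} (hs : MemH1 a b s) : H1 E hab :=
  (⟨fun t => s t, ((hs.hasWeakDeriv hab).congr hab
    (fun _ ht => IccExtend_of_mem hab.le (fun t : Icc a b => s t) ht)
    (Filter.EventuallyEq.refl _ _)).memH1 hab hs.2⟩ : h1Submodule E hab)

theorem fn_ofMemH1 (hab : a < b) {s : ℝ → E} (hs : MemH1 a b s) {t : ℝ} (ht : t ∈ Icc a b) :
    (ofMemH1 hab hs).fn t = s t :=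
  IccExtend_of_mem hab.le (fun t : Icc a b => s t) ht

theorem eq_zero_of_eqOn {hab : a < b} {v : H1 E hab} (hv : ∀ t ∈ Icc a b, v.fn t = 0) : v = 0 := by
  apply Subtype.ext
  funext t
  have h5 : v.fn t = v.1 t := by simp [fn]
  exact h5.symm.trans (hv t t.2)

end H1

theorem contDiffOn_matrix_det {m : WithTop ℕ∞} {κ : Type*} [Fintype κ] [DecidableEq κ]
    {M : ℝ → Matrix κ κ ℝ} {s : Set ℝ} (hM : ∀ i j, ContDiffOn ℝ m (fun t => M t i j) s) :
    ContDiffOn ℝ m (fun t => (M t).det) s := by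
  simp only [Matrix.det_apply']
  exact ContDiffOn.sum fun σ _ => contDiffOn_const.mul (contDiffOn_prod fun i _ => hM _ _)

/-- Cramer's rule: the entries are cofactors divided by the determinant. -/
theorem contDiffOn_matrix_inv {m : WithTop ℕ∞} {κ : Type*} [Fintype κ] [DecidableEq κ]
    {M : ℝ → Matrix κ κ ℝ} {s : Set ℝ} (hM : ∀ i j, ContDiffOn ℝ m (fun t => M t i j) s)
    (hdet : ∀ t ∈ s, (M t).det ≠ 0) (i j : κ) : ContDiffOn ℝ m (fun t => (M t)⁻¹ i j) s := by
  simp only [Matrix.inv_def, Ring.inverse_eq_inv', Matrix.smul_apply, smul_eq_mul,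
    Matrix.adjugate_apply]
  refine ((contDiffOn_matrix_det hM).inv hdet).mul (contDiffOn_matrix_det fun p q => ?_)
  by_cases hp : p = j
  · subst hp
    simpa using contDiffOn_const
  · simpa [Matrix.updateRow_apply, hp] using hM p q

end Constructions

/-! ### The reduced system: regularity of 𝓑, 𝒞, 𝓘 and absence of focal instants -/

namespace SymplecticSystem

variable {n k : ℕ} {a b : ℝ} (X : SymplecticSystem n a b)

theorem B_invB {t : ℝ} (ht : t ∈ Icc a b) (x : Vec n) : X.B t (X.invB t x) = x := by
  obtain ⟨e, he⟩ := X.invertible_B t ht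
  simp [invB, ← he]

theorem invB_symm {t : ℝ} (ht : t ∈ Icc a b) (x y : Vec n) :
    X.invB t x y = X.invB t y x := by
  have h := X.symm_B t ht (X.invB t y) (X.invB t x)
  rwa [X.B_invB ht, X.B_invB ht] at h

theorem contDiffOn_invB : ContDiffOn ℝ 1 X.invB (Icc a b) := fun t ht =>
  (X.invertible_B t ht).contDiffAt_map_inverse.comp_contDiffWithinAt t (X.contDiffOn_B t ht)

/-- One derivative of `y` is spent in α_y. This is where a C² frame matters: it makes 𝒞 of class C¹,
so that 𝒞ₛ' exists and is continuous. -/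
theorem contDiffOn_alpha (hab : a < b) {y : ℝ → Vec n} (hy : ContDiffOn ℝ 2 y (Icc a b)) :
    ContDiffOn ℝ 1 (X.alpha y) (Icc a b) :=
  X.contDiffOn_invB.clm_apply ((hy.derivWithin (uniqueDiffOn_Icc hab) (by norm_num)).sub
    (X.contDiffOn_A.clm_apply (hy.of_le (by norm_num))))

/-- The vector field `v' - A v` along `v`. -/
def defect (v v' : ℝ → Vec n) (t : ℝ) : Vec n := v' t - X.A t (v t)

theorem alpha_apply {t : ℝ} (ht : t ∈ Icc a b) (v : ℝ → Vec n) (y : Vec n) :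
    X.alpha v t y = X.invB t y (X.defect v (derivWithin v (Icc a b)) t) :=
  X.invB_symm ht _ _

theorem formB_alpha {t : ℝ} (ht : t ∈ Icc a b) (v : ℝ → Vec n) (β : Covec n) :
    X.formB t (X.alpha v t) β = β (X.defect v (derivWithin v (Icc a b)) t) := by
  rw [formB, alpha, X.B_invB ht, defect]

section Frame

variable {Y : Fin k → ℝ → Vec n}

theorem contDiffOn_redB (hY : ∀ i, ContDiffOn ℝ 2 (Y i) (Icc a b)) (i j : Fin k) :
    ContDiffOn ℝ 1 (fun t => X.redB Y t i j) (Icc a b) :=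
  (X.contDiffOn_invB.clm_apply ((hY i).of_le (by norm_num))).clm_apply
    ((hY j).of_le (by norm_num))

theorem contDiffOn_redC (hab : a < b) (hY : ∀ i, ContDiffOn ℝ 2 (Y i) (Icc a b)) (i j : Fin k) :
    ContDiffOn ℝ 1 (fun t => X.redC Y t i j) (Icc a b) :=
  (X.contDiffOn_alpha hab (hY j)).clm_apply ((hY i).of_le (by norm_num))

theorem contDiffOn_redCs (hab : a < b) (hY : ∀ i, ContDiffOn ℝ 2 (Y i) (Icc a b)) (i j : Fin k) :
    ContDiffOn ℝ 1 (fun t => X.redCs Y t i j) (Icc a b) :=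
  contDiffOn_const.mul ((X.contDiffOn_redC hab hY i j).add (X.contDiffOn_redC hab hY j i))

theorem contDiffOn_redCa (hab : a < b) (hY : ∀ i, ContDiffOn ℝ 2 (Y i) (Icc a b)) (i j : Fin k) :
    ContDiffOn ℝ 1 (fun t => X.redCa Y t i j) (Icc a b) :=
  contDiffOn_const.mul ((X.contDiffOn_redC hab hY i j).sub (X.contDiffOn_redC hab hY j i))

theorem continuousOn_redCsDeriv (hab : a < b) (hY : ∀ i, ContDiffOn ℝ 2 (Y i) (Icc a b))
    (i j : Fin k) : ContinuousOn (fun t => X.redCsDeriv Y t i j) (Icc a b) :=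
  (X.contDiffOn_redCs hab hY i j).continuousOn_derivWithin (uniqueDiffOn_Icc hab) le_rfl

theorem hasWeakDeriv_redCs (hab : a < b) (hY : ∀ i, ContDiffOn ℝ 2 (Y i) (Icc a b))
    (i j : Fin k) :
    HasWeakDeriv a b (fun t => X.redCs Y t i j) (fun t => X.redCsDeriv Y t i j) :=
  HasWeakDeriv.of_contDiffOn hab (X.contDiffOn_redCs hab hY i j)

theorem continuousOn_redI (hab : a < b) (hY : ∀ i, ContDiffOn ℝ 2 (Y i) (Icc a b)) (i j : Fin k) :
    ContinuousOn (fun t => X.redI Y t i j) (Icc a b) :=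
  ((X.contDiffOn_alpha hab (hY j)).continuousOn.clm_apply
    (X.contDiffOn_B.continuousOn.clm_apply (X.contDiffOn_alpha hab (hY i)).continuousOn)).add
    ((X.continuousOn_C.clm_apply (hY i).continuousOn).clm_apply (hY j).continuousOn)

theorem redC_eq (t : ℝ) : X.redC Y t = X.redCs Y t + X.redCa Y t := by
  rw [redCs, redCa, ← smul_add, add_add_sub_cancel, ← two_smul ℝ, smul_smul]
  norm_num

theorem redC_transpose_eq (t : ℝ) : (X.redC Y t).transpose = X.redCs Y t - X.redCa Y t := by
  rw [redCs, redCa, ← smul_sub, add_sub_sub_cancel, ← two_smul ℝ, smul_smul]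
  norm_num

theorem invB_frame_sum {t : ℝ} (c : Fin k → ℝ) (i : Fin k) :
    X.invB t (Y i t) (∑ j, c j • Y j t) = (X.redB Y t).mulVec c i := by
  simp [Matrix.mulVec, dotProduct, redB, mul_comm]

/-- If 𝓑c = 0, then x = ∑ cⱼYⱼ lies in 𝒟 and B⁻¹(x, x) = 0, so x = 0 by definiteness and c = 0 by
independence of the frame. -/
theorem det_redB_ne_zero {D : ℝ → Submodule ℝ (Vec n)} (hD : X.IsNegativeDistribution k D)
    (hY : IsC2Frame a b Y D) {t : ℝ} (ht : t ∈ Icc a b) : (X.redB Y t).det ≠ 0 := by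
  intro h0
  obtain ⟨c, hc, hc0⟩ := Matrix.exists_mulVec_eq_zero_iff.2 h0
  have hx : ∑ j, c j • Y j t ∈ D t := by
    rw [← hY.span_eq t ht]
    exact Submodule.sum_mem _ fun j _ =>
      Submodule.smul_mem _ _ (Submodule.subset_span (mem_range_self j))
  have hne : ∑ j, c j • Y j t ≠ 0 := fun h =>
    hc (funext (Fintype.linearIndependent_iff.1 (hY.linearIndependent t ht) c h))
  refine (hD.neg t ht _ hx hne).ne ?_
  -- Expand one slot of the form only; the other remains a full sum, so that the entries of 𝓑c
  -- appear.
  conv_lhs => arg 1; rw [map_sum]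
  simp only [map_smul, sum_apply, smul_apply,
    X.invB_frame_sum, hc0]
  simp

/-- The coefficient matrix of the reduced symplectic system. -/
noncomputable def reducedMatrix (Y : Fin k → ℝ → Vec n) (t : ℝ) : Matrix (Fin k ⊕ Fin k) (Fin k ⊕ Fin k) ℝ :=
  Matrix.fromBlocks (-((X.redB Y t)⁻¹ * X.redCa Y t)) (X.redB Y t)⁻¹
    (X.redI Y t - X.redCsDeriv Y t + X.redCa Y t * (X.redB Y t)⁻¹ * X.redCa Y t)
    (-(X.redCa Y t * (X.redB Y t)⁻¹))

theorem continuousOn_reducedMatrix (hab : a < b) (hY : ∀ i, ContDiffOn ℝ 2 (Y i) (Icc a b))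
    (hdet : ∀ t ∈ Icc a b, (X.redB Y t).det ≠ 0) (i j : Fin k ⊕ Fin k) :
    ContinuousOn (fun t => X.reducedMatrix Y t i j) (Icc a b) := by
  have hBi : ∀ i j, ContinuousOn (fun t => (X.redB Y t)⁻¹ i j) (Icc a b) := fun i j =>
    (contDiffOn_matrix_inv (X.contDiffOn_redB hY) hdet i j).continuousOn
  have hCa : ∀ i j, ContinuousOn (fun t => X.redCa Y t i j) (Icc a b) := fun i j =>
    (X.contDiffOn_redCa hab hY i j).continuousOn
  have hmul : ∀ {M M' : ℝ → Matrix (Fin k) (Fin k) ℝ},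
      (∀ i j, ContinuousOn (fun t => M t i j) (Icc a b)) →
      (∀ i j, ContinuousOn (fun t => M' t i j) (Icc a b)) →
      ∀ i j, ContinuousOn (fun t => (M t * M' t) i j) (Icc a b) := fun hM hM' i j => by
    simp only [Matrix.mul_apply]
    exact continuousOn_finsetSum _ fun l _ => (hM i l).mul (hM' l j)
  rcases i with i | i <;> rcases j with j | j
  · exact (hmul hBi hCa i j).neg
  · exact hBi i j
  · exact ((X.continuousOn_redI hab hY i j).sub (X.continuousOn_redCsDeriv hab hY i j)).add
      (hmul (hmul hCa hBi) hCa i j)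
  · exact (hmul hCa hBi i j).neg

theorem reducedMatrix_mulVec_inl (t : ℝ) (z : Fin k ⊕ Fin k → ℝ) :
    ((X.reducedMatrix Y t).mulVec z ∘ Sum.inl : Fin k → ℝ) =
      -(((X.redB Y t)⁻¹ * X.redCa Y t).mulVec (z ∘ Sum.inl)) +
        ((X.redB Y t)⁻¹).mulVec (z ∘ Sum.inr) := by
  rw [reducedMatrix, Matrix.fromBlocks_mulVec, Sum.elim_comp_inl, Matrix.neg_mulVec]

theorem reducedMatrix_mulVec_inr (t : ℝ) (z : Fin k ⊕ Fin k → ℝ) :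
    ((X.reducedMatrix Y t).mulVec z ∘ Sum.inr : Fin k → ℝ) =
      (X.redI Y t - X.redCsDeriv Y t + X.redCa Y t * (X.redB Y t)⁻¹ * X.redCa Y t).mulVec
        (z ∘ Sum.inl) - (X.redCa Y t * (X.redB Y t)⁻¹).mulVec (z ∘ Sum.inr) := by
  rw [reducedMatrix, Matrix.fromBlocks_mulVec, Sum.elim_comp_inr, Matrix.neg_mulVec]
  exact (sub_eq_add_neg _ _).symm

theorem isReducedSolution_of_hasDerivWithinAt {z : ℝ → Fin k ⊕ Fin k → ℝ}
    (hz : ∀ t ∈ Icc a b, HasDerivWithinAt z ((X.reducedMatrix Y t).mulVec (z t)) (Icc a b) t) :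
    X.IsReducedSolution Y (fun t => z t ∘ Sum.inl) (fun t => z t ∘ Sum.inr) := by
  intro t ht
  have h := hasDerivWithinAt_pi.1 (hz t ht)
  rw [← X.reducedMatrix_mulVec_inl, ← X.reducedMatrix_mulVec_inr]
  exact ⟨hasDerivWithinAt_pi.2 fun i => h (Sum.inl i), hasDerivWithinAt_pi.2 fun i => h (Sum.inr i)⟩

/-- A solution of the reduced system without focal instants that vanishes at both ends has
vanishing first component. -/
theorem ReducedHasNoFocalInstants.eq_zero (hab : a < b) (hred : X.ReducedHasNoFocalInstants Y)
    {z : ℝ → Fin k ⊕ Fin k → ℝ}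
    (hz : ∀ t ∈ Icc a b, HasDerivWithinAt z ((X.reducedMatrix Y t).mulVec (z t)) (Icc a b) t)
    (ha : ∀ i, z a (Sum.inl i) = 0) (hb : ∀ i, z b (Sum.inl i) = 0) :
    ∀ t ∈ Icc a b, z t ∘ Sum.inl = 0 := by
  intro t ht
  by_contra hne
  exact hred _ _ (X.isReducedSolution_of_hasDerivWithinAt hz) (funext ha) ⟨t, ht, hne⟩ b
    (right_mem_Ioc.2 hab) (funext hb)

/-- Once f vanishes identically, the first equation at t = a reads 0 = 𝓑⁻¹φ(a), hence φ(a) = 0. This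
is the injectivity hypothesis of the boundary value problem. -/
theorem ReducedHasNoFocalInstants.inr_eq_zero (hab : a < b)
    (hred : X.ReducedHasNoFocalInstants Y) (hdet : ∀ t ∈ Icc a b, (X.redB Y t).det ≠ 0)
    {z : ℝ → Fin k ⊕ Fin k → ℝ}
    (hz : ∀ t ∈ Icc a b, HasDerivWithinAt z ((X.reducedMatrix Y t).mulVec (z t)) (Icc a b) t)
    (ha : ∀ i, z a (Sum.inl i) = 0) (hb : ∀ i, z b (Sum.inl i) = 0) (i : Fin k) :
    z a (Sum.inr i) = 0 := by
  have h0 := ReducedHasNoFocalInstants.eq_zero X hab hred hz ha hb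
  have haI : a ∈ Icc a b := left_mem_Icc.2 hab.le
  have h1 := (X.isReducedSolution_of_hasDerivWithinAt hz a haI).1
  have h2 : HasDerivWithinAt (fun t => z t ∘ Sum.inl) (0 : Fin k → ℝ) (Icc a b) a :=
    (hasDerivWithinAt_const a (Icc a b) (0 : Fin k → ℝ)).congr h0 (h0 a haI)
  have h3 := (uniqueDiffOn_Icc hab a haI).eq_deriv _ h1 h2
  simp only [h0 a haI, Matrix.mulVec_zero, neg_zero, zero_add] at h3
  have hu : IsUnit (X.redB Y a).det := (hdet a haI).isUnit
  have h4 : (X.redB Y a).mulVec (((X.redB Y a)⁻¹).mulVec (z a ∘ Sum.inr)) = 0 := by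
    rw [h3, Matrix.mulVec_zero]
  rw [Matrix.mulVec_mulVec, Matrix.mul_nonsing_inv _ hu, Matrix.one_mulVec] at h4
  exact congrFun h4 i

end Frame

end SymplecticSystem

end SymplecticIndex

namespace SymplecticIndex

/-! ### Elimination of f' from the reduced system -/

section ReductionAlgebra

variable {κ : Type*} [Fintype κ] [DecidableEq κ] {B Ca : Matrix κ κ ℝ} {f f' ψ : κ → ℝ}

theorem neg_inv_mul_mulVec_add (hB : IsUnit B.det) (h : B.mulVec f' = ψ - Ca.mulVec f) :
    -((B⁻¹ * Ca).mulVec f) + B⁻¹.mulVec ψ = f' := by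
  have h1 : B⁻¹.mulVec (B.mulVec f') = f' := by
    rw [Matrix.mulVec_mulVec, Matrix.nonsing_inv_mul _ hB, Matrix.one_mulVec]
  rw [← h1, h, Matrix.mulVec_sub, Matrix.mulVec_mulVec]
  abel

theorem mulVec_of_eq_neg_inv_mul_mulVec_add (hB : IsUnit B.det)
    (h : f' = -((B⁻¹ * Ca).mulVec f) + B⁻¹.mulVec ψ) : B.mulVec f' = ψ - Ca.mulVec f := by
  rw [h, Matrix.mulVec_add, Matrix.mulVec_neg, Matrix.mulVec_mulVec, Matrix.mulVec_mulVec,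
    ← Matrix.mul_assoc, Matrix.mul_nonsing_inv _ hB, Matrix.one_mul, Matrix.one_mulVec]
  abel

/-- Here ψ is the momentum 𝓑f' + 𝒞ₐf. The 𝓑⁻¹ terms of the second equation collapse to -𝒞ₐf'. It is
applied with ψ = φ for sections in 𝒦 and with ψ = φ + u for the forced problem. -/
theorem mulVec_sub_mul_inv_mulVec (hB : IsUnit B.det) (h : B.mulVec f' = ψ - Ca.mulVec f)
    (J : Matrix κ κ ℝ) :
    (J + Ca * B⁻¹ * Ca).mulVec f - (Ca * B⁻¹).mulVec ψ = J.mulVec f - Ca.mulVec f' := by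
  rw [← neg_inv_mul_mulVec_add hB h]
  simp only [Matrix.add_mulVec, Matrix.mulVec_add, Matrix.mulVec_neg, Matrix.mulVec_mulVec,
    Matrix.mul_assoc]
  abel

end ReductionAlgebra

/-! ### The condition defining 𝒦 as a first order condition; closedness of 𝒦 and 𝒮 -/

namespace SymplecticData

variable {n k : ℕ} {a b : ℝ} (X : SymplecticData n a b)

/-- Since Bα_v = v' - Av and B, C are symmetric, both expressions become fixed continuous covectors
applied to v' - Av and v. The right hand side is then automatically in L², so an absolutely
continuous representative is already in H¹. -/
theorem solvesAlong_iff (hab : a < b) {y : ℝ → Vec n} (hy : ContDiffOn ℝ 2 y (Icc a b))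
    (v : H1 (Vec n) hab) :
    X.SolvesAlong v.fn y ↔ ∃ h : ℝ → ℝ,
      HasWeakDeriv a b h
        (fun t => X.alpha y t (X.defect v.fn v.deriv t) + X.C t (y t) (v.fn t)) ∧
      ∀ᵐ t ∂(volume.restrict (Icc a b)), h t = X.invB t (y t) (X.defect v.fn v.deriv t) := by
  have e1 : ∀ t ∈ Icc a b, X.formB t (X.alpha v.fn t) (X.alpha y t) + X.C t (v.fn t) (y t) =
      X.alpha y t (X.defect v.fn v.deriv t) + X.C t (y t) (v.fn t) := fun t ht => by
    rw [X.formB_alpha ht, X.symm_C t ht]; rfl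
  have e2 : ∀ t ∈ Icc a b, X.alpha v.fn t (y t) = X.invB t (y t) (X.defect v.fn v.deriv t) :=
    fun t ht => X.alpha_apply ht _ _
  have hy1 := X.contDiffOn_alpha hab hy
  constructor
  · rintro ⟨h, h1, h2, h3⟩
    refine ⟨h, (h1.hasWeakDeriv hab).congr hab (fun _ _ => rfl) ?_, ?_⟩
    · filter_upwards [h3, ae_restrict_mem measurableSet_Icc] with t h3 ht
      rw [h3, e1 t ht]
    · filter_upwards [h2, ae_restrict_mem measurableSet_Icc] with t h2 ht
      rw [h2, e2 t ht]
  · rintro ⟨h, h1, h2⟩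
    refine ⟨h, h1.memH1 hab ?_, ?_, ?_⟩
    · exact ((v.memH1.2.sub ((v.memH1.memLp hab).clm_apply_of_continuousOn
        X.contDiffOn_A.continuousOn)).clm_apply_of_continuousOn hy1.continuousOn).add
        ((v.memH1.memLp hab).clm_apply_of_continuousOn
          (X.continuousOn_C.clm_apply hy.continuousOn))
    · filter_upwards [h2, ae_restrict_mem measurableSet_Icc] with t h2 ht
      rw [h2, e2 t ht]
    · filter_upwards [h1.derivWithin_ae hab, ae_restrict_mem measurableSet_Icc] with t h1 ht
      rw [h1, e1 t ht]

/-- An absolutely continuous `h` with derivative `g` is h(a) + ∫g, so the quantifier over functions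
`h` reduces to one over a real constant. -/
theorem isClosed_setOf_solvesAlong (hab : a < b) {y : ℝ → Vec n}
    (hy : ContDiffOn ℝ 2 y (Icc a b)) :
    IsClosed {v : H1 (Vec n) hab | X.SolvesAlong v.fn y} := by
  have hp : ContinuousOn (fun t => X.invB t (y t)) (Icc a b) :=
    X.contDiffOn_invB.continuousOn.clm_apply hy.continuousOn
  have hp' := (X.contDiffOn_alpha hab hy).continuousOn
  have hA := X.contDiffOn_A.continuousOn
  convert isClosed_setOf_firstOrder_eq_primitive hab hp (hp.clm_comp hA).neg hp'
    ((X.continuousOn_C.clm_apply hy.continuousOn).sub (hp'.clm_comp hA)) using 1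
  ext v
  rw [mem_ofPred_eq, mem_ofPred_eq, X.solvesAlong_iff hab hy]
  set u : ℝ → ℝ := fun t => X.invB t (y t) (X.defect v.fn v.deriv t) with hu
  set g : ℝ → ℝ := fun t => X.alpha y t (X.defect v.fn v.deriv t) + X.C t (y t) (v.fn t) with hg
  have eu : ∀ t, X.invB t (y t) (v.deriv t) +
      (-fun t => (X.invB t (y t)).comp (X.A t)) t (v.fn t) = u t := fun t => by
    simp [hu, SymplecticSystem.defect, sub_eq_add_neg]
  have eg : (fun s => X.alpha y s (v.deriv s) +
      ((fun t => X.C t (y t)) - fun t => (X.alpha y t).comp (X.A t)) s (v.fn s)) = g := by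
    funext t
    simp [hg, SymplecticSystem.defect]
    ring
  have hgi : IntegrableOn g (Icc a b) := by
    rw [← eg]
    exact (H1.memLp_firstOrder hp' ((X.continuousOn_C.clm_apply hy.continuousOn).sub
      (hp'.clm_comp hA)) v).integrableOn_Icc
  have haI : a ∈ Icc a b := left_mem_Icc.2 hab.le
  constructor
  · rintro ⟨h, h1, h2⟩
    refine ⟨h a, ?_⟩
    filter_upwards [h2, ae_restrict_mem measurableSet_Icc] with t h2 ht
    refine (eu t).trans (h2.symm.trans ?_)
    have := h1.integral_eq_sub haI ht
    rw [← eg] at this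
    refine Eq.trans ?_ (congrArg (fun x => h a + x) this.symm)
    ring
  · rintro ⟨c, hc⟩
    refine ⟨fun t => c + ∫ s in a..t, g s, ?_, ?_⟩
    · refine ((HasWeakDeriv.of_classical hab (f := fun _ => c) (g := fun _ => 0)
        continuousOn_const fun t _ => hasDerivWithinAt_const t _ _).add
        (HasWeakDeriv.primitive hab hgi)).congr hab (fun _ _ => rfl) ?_
      exact Filter.Eventually.of_forall fun t => (zero_add _).symm
    · filter_upwards [hc] with t hc
      rw [← eg]
      exact hc.symm.trans (eu t)

theorem isClosed_calK (hab : a < b) {Y : Fin k → ℝ → Vec n}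
    (hY : ∀ i, ContDiffOn ℝ 2 (Y i) (Icc a b)) :
    IsClosed (X.calK hab Y : Set (X.calH hab)) := by
  have : (X.calK hab Y : Set (X.calH hab)) =
      ⋂ i, Subtype.val ⁻¹' {v : H1 (Vec n) hab | X.SolvesAlong v.fn (Y i)} := by
    ext v
    simp only [mem_iInter]
    exact Iff.rfl
  rw [this]
  exact isClosed_iInter fun i =>
    (X.isClosed_setOf_solvesAlong hab (hY i)).preimage continuous_subtype_val

theorem isClosed_calS (hab : a < b) (D : ℝ → Submodule ℝ (Vec n)) :
    IsClosed (X.calS hab D : Set (X.calH hab)) := by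
  have hev : ∀ {t}, t ∈ Icc a b → Continuous fun v : X.calH hab => v.1.fn t := fun ht =>
    (H1.continuous_eval ht).comp continuous_subtype_val
  have : (X.calS hab D : Set (X.calH hab)) =
      {v | v.1.fn a = 0} ∩ ({v | v.1.fn b = 0} ∩
        ⋂ t : Icc a b, (fun v : X.calH hab => v.1.fn t) ⁻¹' (D t : Set (Vec n))) := by
    ext v
    simp only [mem_inter_iff, mem_iInter, Subtype.forall]
    exact Iff.rfl
  rw [this]
  refine (isClosed_eq (hev (left_mem_Icc.2 hab.le)) continuous_const).inter
    ((isClosed_eq (hev (right_mem_Icc.2 hab.le)) continuous_const).inter ?_)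
  exact isClosed_iInter fun t =>
    ((D t).closed_of_finiteDimensional).preimage (hev t.2)

end SymplecticData

/-! ### The system evaluated on sections ∑ fⱼYⱼ of 𝒟 -/

namespace SymplecticSystem

variable {n k : ℕ} {a b : ℝ} (X : SymplecticSystem n a b) {Y : Fin k → ℝ → Vec n}
  {f f' : ℝ → Fin k → ℝ}

/-- The derivative of `∑ fⱼ Yⱼ`. -/
noncomputable def frameDeriv (a b : ℝ) (Y : Fin k → ℝ → Vec n) (f f' : ℝ → Fin k → ℝ) (t : ℝ) :
    Vec n :=
  ∑ j, (f t j • derivWithin (Y j) (Icc a b) t + f' t j • Y j t)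

theorem hasWeakDeriv_frame (hab : a < b) (hY : ∀ i, ContDiffOn ℝ 2 (Y i) (Icc a b))
    (hf : ∀ j, HasWeakDeriv a b (fun t => f t j) (fun t => f' t j)) :
    HasWeakDeriv a b (fun t => ∑ j, f t j • Y j t) (frameDeriv a b Y f f') :=
  HasWeakDeriv.sum _ fun j _ =>
    (hf j).smul (HasWeakDeriv.of_contDiffOn hab ((hY j).of_le (by norm_num)))

/-- Leibniz rule, together with Yⱼ' - AYⱼ = Bα_{Yⱼ}. -/
theorem defect_frame {t : ℝ} (ht : t ∈ Icc a b) :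
    X.defect (fun t => ∑ j, f t j • Y j t) (frameDeriv a b Y f f') t =
      ∑ j, (f t j • X.B t (X.alpha (Y j) t) + f' t j • Y j t) := by
  simp only [defect, frameDeriv, alpha, X.B_invB ht, map_sum, map_smul,
    ← Finset.sum_sub_distrib, smul_sub]
  exact Finset.sum_congr rfl fun j _ => by abel

theorem invB_defect_frame {t : ℝ} (ht : t ∈ Icc a b) (i : Fin k) :
    X.invB t (Y i t) (X.defect (fun t => ∑ j, f t j • Y j t) (frameDeriv a b Y f f') t) =
      (X.redC Y t).mulVec (f t) i + (X.redB Y t).mulVec (f' t) i := by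
  simp only [X.defect_frame ht, map_sum, map_add, map_smul, Matrix.mulVec, dotProduct, redC, redB,
    ← Finset.sum_add_distrib, Matrix.of_apply, smul_eq_mul]
  refine Finset.sum_congr rfl fun j _ => ?_
  rw [X.invB_symm ht (Y i t) (X.B t _)]
  have : X.invB t (X.B t (X.alpha (Y j) t)) = X.alpha (Y j) t := by
    conv_lhs => rw [alpha, X.B_invB ht]
    rfl
  rw [this]
  ring

theorem alpha_defect_frame {t : ℝ} (ht : t ∈ Icc a b) (i : Fin k) :
    X.alpha (Y i) t (X.defect (fun t => ∑ j, f t j • Y j t) (frameDeriv a b Y f f') t) +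
      X.C t (Y i t) (∑ j, f t j • Y j t) =
      (X.redI Y t).mulVec (f t) i + (X.redC Y t).transpose.mulVec (f' t) i := by
  simp only [X.defect_frame ht, map_sum, map_add, map_smul, Matrix.mulVec, dotProduct, redC, redI,
    ← Finset.sum_add_distrib, Matrix.of_apply, smul_eq_mul, Matrix.transpose_apply, formB]
  refine Finset.sum_congr rfl fun j _ => ?_
  rw [X.symm_B t ht (X.alpha (Y j) t)]
  ring

/-- Accounts for the shift φ = u - 𝒞ₛf, and so for the term 𝒞ₛ' in the reduced system. -/
theorem hasWeakDeriv_redCs_mulVec (hab : a < b) (hY : ∀ i, ContDiffOn ℝ 2 (Y i) (Icc a b))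
    (hf : ∀ j, HasWeakDeriv a b (fun t => f t j) (fun t => f' t j)) (i : Fin k) :
    HasWeakDeriv a b (fun t => (X.redCs Y t).mulVec (f t) i)
      (fun t => (X.redCs Y t).mulVec (f' t) i + (X.redCsDeriv Y t).mulVec (f t) i) := by
  refine (HasWeakDeriv.sum Finset.univ fun j _ =>
    (X.hasWeakDeriv_redCs hab hY i j).mul (hf j)).congr hab (fun _ _ => rfl)
    (Filter.Eventually.of_forall fun t => ?_)
  simp only [Matrix.mulVec, dotProduct, ← Finset.sum_add_distrib]

end SymplecticSystem

end SymplecticIndex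

namespace SymplecticIndex

theorem hasWeakDeriv_coord {n : ℕ} {a b : ℝ} {v v' : ℝ → Vec n} (hv : HasWeakDeriv a b v v')
    (l : Fin n) : HasWeakDeriv a b (fun t => v t l) (fun t => v' t l) :=
  hv.clm_comp (EuclideanSpace.proj l : Vec n →L[ℝ] ℝ)

namespace SymplecticSystem

variable {n k : ℕ} {a b : ℝ} (X : SymplecticSystem n a b) {Y : Fin k → ℝ → Vec n}
  {D : ℝ → Submodule ℝ (Vec n)}

/-- An absolutely continuous section of a distribution has absolutely continuous coordinates in
a frame. -/
theorem exists_frame_coordinates (hab : a < b) (hD : X.IsNegativeDistribution k D)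
    (hY : IsC2Frame a b Y D) {v v' : ℝ → Vec n} (hv : HasWeakDeriv a b v v')
    (hvD : ∀ t ∈ Icc a b, v t ∈ D t) :
    ∃ f f' : ℝ → Fin k → ℝ, (∀ j, HasWeakDeriv a b (fun t => f t j) (fun t => f' t j)) ∧
      (∀ t ∈ Icc a b, v t = ∑ j, f t j • Y j t) ∧ ∀ t, v t = 0 → f t = 0 := by
  have hdet : ∀ t ∈ Icc a b, (X.redB Y t).det ≠ 0 := fun t ht => X.det_redB_ne_zero hD hY ht
  set e : Fin n → Vec n := fun l => EuclideanSpace.basisFun (Fin n) ℝ l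
  have hsum : ∀ (t : ℝ) j, X.invB t (Y j t) (v t) = ∑ l, X.invB t (Y j t) (e l) * v t l :=
    -- Expanding v in the standard basis turns the pairing into a finite sum of C¹ functions times
    -- absolutely continuous ones.
    fun t j => by
      conv_lhs => rw [← (EuclideanSpace.basisFun (Fin n) ℝ).sum_repr (v t)]
      simp [e, mul_comm]
  have h1 : ∀ i j, HasWeakDeriv a b (fun t => (X.redB Y t)⁻¹ i j) _ := fun i j =>
    HasWeakDeriv.of_contDiffOn hab (contDiffOn_matrix_inv (X.contDiffOn_redB hY.contDiffOn) hdet i j)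
  have h2 : ∀ j l, HasWeakDeriv a b (fun t => X.invB t (Y j t) (e l)) _ := fun j l =>
    HasWeakDeriv.of_contDiffOn hab ((X.contDiffOn_invB.clm_apply
      ((hY.contDiffOn j).of_le (by norm_num))).clm_apply contDiffOn_const)
  have h3 : ∀ i, ∃ f' : ℝ → ℝ, HasWeakDeriv a b
      (fun t => ((X.redB Y t)⁻¹).mulVec (fun j => X.invB t (Y j t) (v t)) i) f' := fun i => by
    simp only [Matrix.mulVec, dotProduct, hsum]
    exact ⟨_, HasWeakDeriv.sum Finset.univ fun j _ => (h1 i j).mul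
      (HasWeakDeriv.sum Finset.univ fun l _ => (h2 j l).mul (hasWeakDeriv_coord hv l))⟩
  choose f' hf' using h3
  -- The coordinates are read off by pairing v with the frame under B⁻¹ and inverting the Gram
  -- matrix 𝓑.
  refine ⟨fun t => ((X.redB Y t)⁻¹).mulVec fun j => X.invB t (Y j t) (v t), fun t i => f' i t,
    hf', fun t ht => ?_, fun t ht => ?_⟩
  · have hm := hvD t ht
    rw [← hY.span_eq t ht, Submodule.mem_span_range_iff_exists_fun] at hm
    obtain ⟨c, hc⟩ := hm
    have : (((X.redB Y t)⁻¹).mulVec fun j => X.invB t (Y j t) (v t)) = c := by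
      have h4 : (fun j => X.invB t (Y j t) (v t)) = (X.redB Y t).mulVec c :=
        funext fun j => by rw [← hc, X.invB_frame_sum]
      rw [h4, Matrix.mulVec_mulVec, Matrix.nonsing_inv_mul _ (hdet t ht).isUnit, Matrix.one_mulVec]
    simp only [this, hc]
  · have : (fun j => X.invB t (Y j t) (v t)) = 0 := funext fun j => by simp [ht]
    simp only [this, Matrix.mulVec_zero]

end SymplecticSystem

/-! ### The decomposition ℋ = 𝒦 ⊕ 𝒮 -/

namespace SymplecticData

variable {n k : ℕ} {a b : ℝ} (X : SymplecticData n a b) {Y : Fin k → ℝ → Vec n}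
  {D : ℝ → Submodule ℝ (Vec n)}

theorem disjoint_calK_calS (hab : a < b) (hD : X.IsNegativeDistribution k D)
    (hY : IsC2Frame a b Y D) (hred : X.ReducedHasNoFocalInstants Y) :
    Disjoint (X.calK hab Y) (X.calS hab D) := by
  rw [Submodule.disjoint_def]
  rintro v hK ⟨hva, hvb, hvD⟩
  have hdet : ∀ t ∈ Icc a b, (X.redB Y t).det ≠ 0 := fun t ht => X.det_redB_ne_zero hD hY ht
  obtain ⟨f, f', hf, hvf, hf0⟩ := X.exists_frame_coordinates hab hD hY v.1.hasWeakDeriv hvD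
  choose h hh hhu using fun i => (X.solvesAlong_iff hab (hY.contDiffOn i) v.1).1 (hK i)
  have hderiv : v.1.deriv =ᵐ[volume.restrict (Icc a b)]
      SymplecticSystem.frameDeriv a b Y f f' :=
    ((SymplecticSystem.hasWeakDeriv_frame hab hY.contDiffOn hf).congr hab hvf
      (Filter.EventuallyEq.refl _ _)).derivWithin_ae hab
  have hdefect : ∀ᵐ t ∂(volume.restrict (Icc a b)), X.defect v.1.fn v.1.deriv t =
      X.defect (fun t => ∑ j, f t j • Y j t) (SymplecticSystem.frameDeriv a b Y f f') t := by
    filter_upwards [hderiv, ae_restrict_mem measurableSet_Icc] with t h1 ht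
    rw [SymplecticSystem.defect, SymplecticSystem.defect, h1, hvf t ht]
  have hrel : ∀ᵐ t ∂(volume.restrict (Icc a b)), (X.redB Y t).mulVec (f' t) =
      ((fun i => h i t) - (X.redCs Y t).mulVec (f t)) - (X.redCa Y t).mulVec (f t) := by
    filter_upwards [ae_all_iff.2 hhu, hdefect, ae_restrict_mem measurableSet_Icc] with t h1 h2 ht
    have h3 : (fun i => h i t) = (X.redC Y t).mulVec (f t) + (X.redB Y t).mulVec (f' t) :=
      funext fun i => by rw [h1 i, h2, X.invB_defect_frame ht, Pi.add_apply]
    rw [h3, X.redC_eq, Matrix.add_mulVec]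
    abel
  -- The pair (f, φ) with φ = h - 𝒞ₛf, where `h` is the absolutely continuous representative of u.
  -- Using `h` makes φ absolutely continuous, although f' is known only almost everywhere.
  set z : ℝ → Fin k ⊕ Fin k → ℝ := fun t =>
    Sum.elim (f t) ((fun i => h i t) - (X.redCs Y t).mulVec (f t)) with hz
  have hweak : ∀ i, HasWeakDeriv a b (fun t => z t i)
      (fun t => (X.reducedMatrix Y t).mulVec (z t) i) := by
    rintro (i | i)
    · refine (hf i).congr hab (fun _ _ => rfl) ?_
      filter_upwards [hrel, ae_restrict_mem measurableSet_Icc] with t h1 ht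
      refine (congrFun (X.reducedMatrix_mulVec_inl t (z t)) i).trans ?_
      rw [hz, Sum.elim_comp_inl, Sum.elim_comp_inr,
        neg_inv_mul_mulVec_add (hdet t ht).isUnit h1]
    · refine ((hh i).sub (X.hasWeakDeriv_redCs_mulVec hab hY.contDiffOn hf i)).congr hab
        (fun _ _ => rfl) ?_
      filter_upwards [hrel, hdefect, ae_restrict_mem measurableSet_Icc] with t h1 h2 ht
      refine (congrFun (X.reducedMatrix_mulVec_inr t (z t)) i).trans ?_
      rw [hz, Sum.elim_comp_inl, Sum.elim_comp_inr,
        mulVec_sub_mul_inv_mulVec (hdet t ht).isUnit h1, h2, hvf t ht, X.alpha_defect_frame ht,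
        X.redC_transpose_eq]
      simp only [Matrix.sub_mulVec, Pi.sub_apply]
      ring
  have hzero := SymplecticSystem.ReducedHasNoFocalInstants.eq_zero X.toSymplecticSystem hab hred
    (hasDerivWithinAt_of_hasWeakDeriv_mulVec hab
      (X.continuousOn_reducedMatrix hab hY.contDiffOn hdet) hweak)
    (congrFun (hf0 a hva)) (congrFun (hf0 b hvb))
  refine Subtype.ext (H1.eq_zero_of_eqOn fun t ht => ?_)
  have : f t = 0 := hzero t ht
  simp [hvf t ht, this]

theorem exists_mem_calS_sub_mem_calK (hab : a < b) (hD : X.IsNegativeDistribution k D)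
    (hY : IsC2Frame a b Y D) (hred : X.ReducedHasNoFocalInstants Y) (v : X.calH hab) :
    ∃ s ∈ X.calS hab D, v - s ∈ X.calK hab Y := by
  have hdet : ∀ t ∈ Icc a b, (X.redB Y t).det ≠ 0 := fun t ht => X.det_redB_ne_zero hD hY ht
  have hN := X.continuousOn_reducedMatrix hab hY.contDiffOn hdet
  set u : ℝ → Fin k → ℝ := fun t i => X.invB t (Y i t) (X.defect v.1.fn v.1.deriv t) with hu
  set g : ℝ → Fin k → ℝ := fun t i =>
    X.alpha (Y i) t (X.defect v.1.fn v.1.deriv t) + X.C t (Y i t) (v.1.fn t) with hg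
  have hvL : MemLp v.1.fn 2 (volume.restrict (Icc a b)) := v.1.memH1.memLp hab
  have hdL : MemLp (X.defect v.1.fn v.1.deriv) 2 (volume.restrict (Icc a b)) :=
    v.1.memH1.2.sub (hvL.clm_apply_of_continuousOn X.contDiffOn_A.continuousOn)
  have huL : ∀ i, MemLp (fun t => u t i) 2 (volume.restrict (Icc a b)) := fun i =>
    hdL.clm_apply_of_continuousOn
      (X.contDiffOn_invB.continuousOn.clm_apply (hY.contDiffOn i).continuousOn)
  have hgL : ∀ i, MemLp (fun t => g t i) 2 (volume.restrict (Icc a b)) := fun i =>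
    (hdL.clm_apply_of_continuousOn (X.contDiffOn_alpha hab (hY.contDiffOn i)).continuousOn).add
      (hvL.clm_apply_of_continuousOn (X.continuousOn_C.clm_apply (hY.contDiffOn i).continuousOn))
  have hNu : ∀ i, MemLp (fun t => (X.reducedMatrix Y t).mulVec (Sum.elim 0 (u t)) i) 2
      (volume.restrict (Icc a b)) := fun i => by
    simp only [Matrix.mulVec, dotProduct]
    refine memLp_finsetSum _ fun j _ => MemLp.continuousOn_mul (hN i j) ?_
    rcases j with j | j
    · exact MemLp.zero
    · exact huL j
  -- The momentum of the sought section is φ + u, but u is merely L² and cannot be part of an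
  -- absolutely continuous unknown. The unknown is therefore (f, φ), with (f, φ)' = N(f, φ + u) -
  -- (0, g), which leaves the forcing r = N(0, u) - (0, g).
  set r : ℝ → Fin k ⊕ Fin k → ℝ := fun t =>
    (X.reducedMatrix Y t).mulVec (Sum.elim 0 (u t)) - Sum.elim (0 : Fin k → ℝ) (g t) with hr
  have hrL : ∀ i, MemLp (fun t => r t i) 2 (volume.restrict (Icc a b)) := fun i => by
    refine (hNu i).sub ?_
    rcases i with i | i
    · exact MemLp.zero
    · exact hgL i
  obtain ⟨z, hza, hzb, hz⟩ := exists_boundary_value_solution hab hN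
    (fun z hz ha hb => SymplecticSystem.ReducedHasNoFocalInstants.inr_eq_zero
      X.toSymplecticSystem hab hred hdet hz ha hb) fun i => (hrL i).integrableOn_Icc
  have hzc : ContinuousOn z (Icc a b) := continuousOn_pi.2 fun i => (hz i).continuousOn hab
  set f : ℝ → Fin k → ℝ := fun t => z t ∘ Sum.inl with hf
  set φ : ℝ → Fin k → ℝ := fun t => z t ∘ Sum.inr with hφ
  set f' : ℝ → Fin k → ℝ := fun t i => (X.reducedMatrix Y t).mulVec (z t) (Sum.inl i) +
    r t (Sum.inl i) with hf'
  have hfw : ∀ j, HasWeakDeriv a b (fun t => f t j) (fun t => f' t j) := fun j => hz (Sum.inl j)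
  have hf'L : ∀ j, MemLp (fun t => f' t j) 2 (volume.restrict (Icc a b)) := fun j =>
    (continuousOn_pi.1 (continuousOn_mulVec hN hzc) (Sum.inl j)).memLp_Icc.add (hrL _)
  have hrel : ∀ t ∈ Icc a b,
      (X.redB Y t).mulVec (f' t) = (φ t + u t) - (X.redCa Y t).mulVec (f t) := fun t ht => by
    refine mulVec_of_eq_neg_inv_mul_mulVec_add (hdet t ht).isUnit ?_
    have h1 := X.reducedMatrix_mulVec_inl (Y := Y) t (z t)
    have h2 := X.reducedMatrix_mulVec_inl (Y := Y) t (Sum.elim 0 (u t))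
    rw [Sum.elim_comp_inl, Sum.elim_comp_inr, Matrix.mulVec_zero, neg_zero, zero_add] at h2
    have h3 : f' t = (X.reducedMatrix Y t).mulVec (z t) ∘ Sum.inl +
        (X.reducedMatrix Y t).mulVec (Sum.elim 0 (u t)) ∘ Sum.inl := by
      funext i
      simp [hf', hr]
    rw [h3, h1, h2, Matrix.mulVec_add, add_assoc]
  have hφw : ∀ i, HasWeakDeriv a b (fun t => φ t i) (fun t =>
      ((X.redI Y t - X.redCsDeriv Y t).mulVec (f t) - (X.redCa Y t).mulVec (f' t)) i - g t i) :=
    fun i => by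
      refine (hz (Sum.inr i)).congr hab (fun _ _ => rfl) ?_
      filter_upwards [ae_restrict_mem measurableSet_Icc] with t ht
      rw [← mulVec_sub_mul_inv_mulVec (hdet t ht).isUnit (hrel t ht)]
      have h1 := congrFun (X.reducedMatrix_mulVec_inr (Y := Y) t (z t)) i
      have h2 := congrFun (X.reducedMatrix_mulVec_inr (Y := Y) t (Sum.elim 0 (u t))) i
      rw [Sum.elim_comp_inl, Sum.elim_comp_inr, Matrix.mulVec_zero, zero_sub] at h2
      simp only [Function.comp_apply, Pi.neg_apply, Pi.sub_apply] at h1 h2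
      simp only [hr, Pi.sub_apply, Sum.elim_inr, h1, h2, Matrix.mulVec_add, Pi.add_apply]
      ring
  have hsw := SymplecticSystem.hasWeakDeriv_frame hab hY.contDiffOn hfw
  have hfc : ∀ j, ContinuousOn (fun t => f t j) (Icc a b) := fun j => (hfw j).continuousOn hab
  have hsL : MemLp (SymplecticSystem.frameDeriv a b Y f f') 2 (volume.restrict (Icc a b)) := by
    refine memLp_finsetSum _ fun j _ => MemLp.add ?_ ?_
    · exact ((hfc j).smul ((hY.contDiffOn j).continuousOn_derivWithin (uniqueDiffOn_Icc hab)
        (by norm_num))).memLp_Icc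
    -- The product f'ⱼYⱼ is seen as a continuous family of operators applied to an L² function.
    · have hL : ContinuousOn (fun t => ContinuousLinearMap.toSpanSingleton ℝ (Y j t)) (Icc a b) :=
        (ContinuousLinearMap.toSpanSingletonCLE (𝕜 := ℝ) (E := Vec n)).continuous.comp_continuousOn
          (hY.contDiffOn j).continuousOn
      simpa using (hf'L j).clm_apply_of_continuousOn hL
  have hsH := hsw.memH1 hab hsL
  set s : H1 (Vec n) hab := H1.ofMemH1 hab hsH
  have hsfn : ∀ t ∈ Icc a b, s.fn t = ∑ j, f t j • Y j t := fun t ht => H1.fn_ofMemH1 hab hsH ht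
  have haI : a ∈ Icc a b := left_mem_Icc.2 hab.le
  have hbI : b ∈ Icc a b := right_mem_Icc.2 hab.le
  have hsa : s.fn a = 0 := by simp [hsfn a haI, hf, hza]
  have hsb : s.fn b = 0 := by simp [hsfn b hbI, hf, hzb]
  refine ⟨⟨s, by rw [hsa]; exact X.P.zero_mem, hsb⟩, ⟨hsa, hsb, fun t ht => ?_⟩, fun i => ?_⟩
  · change s.fn t ∈ D t
    rw [hsfn t ht, ← hY.span_eq t ht]
    exact Submodule.sum_mem _ fun j _ =>
      Submodule.smul_mem _ _ (Submodule.subset_span (mem_range_self j))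
  · have hw : HasWeakDeriv a b (v.1 - s).fn
        (fun t => v.1.deriv t - SymplecticSystem.frameDeriv a b Y f f' t) :=
      (v.1.hasWeakDeriv.sub hsw).congr hab
        (fun t ht => congrArg (fun x => v.1.fn t - x) (hsfn t ht)) (Filter.EventuallyEq.refl _ _)
    have hdef : ∀ᵐ t ∂(volume.restrict (Icc a b)),
        X.defect (v.1 - s).fn (v.1 - s).deriv t = X.defect v.1.fn v.1.deriv t -
          X.defect (fun t => ∑ j, f t j • Y j t) (SymplecticSystem.frameDeriv a b Y f f') t := by
      filter_upwards [hw.derivWithin_ae hab, ae_restrict_mem measurableSet_Icc] with t h1 ht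
      have h2 : (v.1 - s).deriv t = _ := h1
      have h3 : (v.1 - s).fn t = v.1.fn t - s.fn t := rfl
      simp only [SymplecticSystem.defect, h2, h3, hsfn t ht, map_sub]
      abel
    refine (X.solvesAlong_iff hab (hY.contDiffOn i) (v.1 - s)).2
      -- From 𝓑f' = φ + u - 𝒞ₐf, the expression of v - s is u - 𝒞f - 𝓑f' = -(φ + 𝒞ₛf), which is
      -- absolutely continuous.
      ⟨fun t => -(φ t i + (X.redCs Y t).mulVec (f t) i), ?_, ?_⟩
    · refine ((hφw i).add (X.hasWeakDeriv_redCs_mulVec hab hY.contDiffOn hfw i)).neg.congr hab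
        (fun _ _ => rfl) ?_
      filter_upwards [hdef, ae_restrict_mem measurableSet_Icc] with t h1 ht
      have h3 : (v.1 - s).fn t = v.1.fn t - ∑ j, f t j • Y j t :=
        congrArg (fun x => v.1.fn t - x) (hsfn t ht)
      have h4 := X.alpha_defect_frame (Y := Y) (f := f) (f' := f') ht i
      rw [X.redC_transpose_eq] at h4
      simp only [Matrix.sub_mulVec, Pi.sub_apply] at h4
      simp only [h1, h3, map_sub, hg, Matrix.sub_mulVec, Pi.sub_apply]
      linarith
    · filter_upwards [hdef, ae_restrict_mem measurableSet_Icc] with t h1 ht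
      have h4 := congrFun (hrel t ht) i
      simp only [Pi.sub_apply, Pi.add_apply, hu] at h4
      rw [h1, map_sub, X.invB_defect_frame ht, X.redC_eq, Matrix.add_mulVec, Pi.add_apply]
      linarith

end SymplecticData

end SymplecticIndex

theorem corollary2p6p10 {n k : ℕ} {a b : ℝ} (hab : a < b)
    (X : SymplecticIndex.SymplecticData n a b)
    (hk : ∀ t ∈ Icc a b, SymplecticIndex.negIndex (X.formB t) = k)
    (D : ℝ → Submodule ℝ (SymplecticIndex.Vec n))
    (hD : X.IsNegativeDistribution k D)
    (Y : Fin k → ℝ → SymplecticIndex.Vec n)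
    (hY : SymplecticIndex.IsC2Frame a b Y D)
    (hred : X.ReducedHasNoFocalInstants Y) :
    IsClosed (X.calK hab Y : Set (X.calH hab)) ∧
      IsClosed (X.calS hab D : Set (X.calH hab)) ∧
      IsCompl (X.calK hab Y) (X.calS hab D) := by
  refine ⟨X.isClosed_calK hab hY.contDiffOn, X.isClosed_calS hab D,
    X.disjoint_calK_calS hab hD hY hred, codisjoint_iff.2 (eq_top_iff.2 fun v _ => ?_)⟩
  obtain ⟨s, hs, hvs⟩ := X.exists_mem_calS_sub_mem_calK hab hD hY hred v
  exact Submodule.mem_sup.2 ⟨v - s, hvs, s, hs, sub_add_cancel v s⟩
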